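/- Let $n\ge 0$ be an integer. Consider concave functions $f:Q\to\mathbb{R}$, bounded below, defined on nonempty compact convex sets $Q\subset\mathbb{R}^n$ (such functions are automatically bounded above and Lebesgue integrable on $Q$). For $f:Q\to\mathbb{R}$ and $g:R\to\mathbb{R}$ let the sup-convolution be $$f\boxplus g:\ Q+R\to\mathbb{R},\qquad x\mapsto \sup\{f(y)+g(z)\,:\ y\in Q,\ z\in R,\ y+z=x\},$$ which is again a concave function, bounded below, on the Minkowski sum $Q+R$; the operation $\boxplus$ is commutative and associative. The mixed integral of $f_0:Q_0\to\mathbb{R},\dots,f_n:Q_n\to\mathbb{R}$ is $$\mathrm{MI}(f_0,\dots,f_n):=\sum_{j=0}^n(-1)^{n-j}\sum_{0\le i_0<\cdots<i_j\le n}\int_{Q_{i_0}+\cdots+Q_{i_j}} f_{i_0}\boxplus\cdots\boxplus f_{i_j}\,dx_1\cdots dx_n .$$ For $m\ge 1$ the mixed volume of bounded convex sets $K_1,\dots,K_m\subset\mathbb{R}^m$ is $$\mathrm{MV}_m(K_1,\dots,K_m):=\sum_{j=1}^m(-1)^{m-j}\sum_{1\le i_1<\cdots<i_j\le m}\mathrm{Vol}_m(K_{i_1}+\cdots+K_{i_j}).$$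 For $f:Q\to\mathbb{R}$ as above and $\mu\le \inf_Q f$ put $$Q_{f,\mu}:=\mathrm{Conv}\big(\{(x,f(x)) : x\in Q\}\cup\{(x,\mu): x\in Q\}\big)\subset\mathbb{R}^{n+1}.$$ Then: (a) $\mathrm{MI}(f_0,\dots,f_n)$ is symmetric in $f_0,\dots,f_n$, and it is additive in each variable with respect to $\boxplus$, that is, $$\mathrm{MI}(f_0,\dots,g\boxplus h,\dots,f_n)=\mathrm{MI}(f_0,\dots,g,\dots,f_n)+\mathrm{MI}(f_0,\dots,h,\dots,f_n).$$ (b) $\mathrm{MI}(f,\dots,f)=(n+1)!\int_Q f\,dx_1\cdots dx_n$ for every $f:Q\to\mathbb{R}$. (c) $\mathrm{MI}(f_0,\dots,f_n)\ge 0$ if $f_0\ge 0,\dots,f_n\ge 0$. (d) Suppose $n\ge 1$, and let $\mu_0,\dots,\mu_n$ be real numbers with $\mu_i\le\min(\inf_{Q_i} f_i,\,0)$ for $i=0,\dots,n$. Then $$\mathrm{MI}(f_0,\dots,f_n)=\mathrm{MV}_{n+1}(Q_{f_0,\mu_0},\dots,Q_{f_n,\mu_n})+\sum_{i=0}^n\mu_i\,\mathrm{MV}_n(Q_0,\dots,Q_{i-1},Q_{i+1},\dots,Q_n).$$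 -/

import Mathlib

open MeasureTheory
open scoped Pointwise

noncomputable section

/-- A concave function `f : Q → ℝ` bounded below, on a nonempty compact convex set `Q ⊆ ℝⁿ`.
Such a function is recorded by its domain `Q` and its values on `Q`; outside `Q`, where it is not
defined, `toFun` takes the conventional value `0`, so that equality of two such objects is
equality of domains and of functions on them. -/
structure ConcaveFn (n : ℕ) where
  /-- The domain `Q`: a nonempty compact convex subset of `ℝⁿ`. -/
  dom : ConvexBody (Fin n → ℝ)
  /-- The function, with value `0` off its domain. -/
  toFun : (Fin n → ℝ) → ℝ
  concaveOn : ConcaveOn ℝ (dom : Set (Fin n → ℝ)) toFun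
  bddBelow : BddBelow (toFun '' (dom : Set (Fin n → ℝ)))
  toFun_off : ∀ x, x ∉ dom → toFun x = 0

namespace ConcaveFn

variable {n : ℕ}

instance : CoeFun (ConcaveFn n) (fun _ => (Fin n → ℝ) → ℝ) := ⟨ConcaveFn.toFun⟩

theorem ext_of {f g : ConcaveFn n} (hd : f.dom = g.dom) (h : ∀ x ∈ f.dom, f x = g x) : f = g := by
  have h2 : f.toFun = g.toFun := by
    funext x
    by_cases hx : x ∈ f.dom
    · exact h x hx
    · rw [f.toFun_off x hx, g.toFun_off x (hd ▸ hx)]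
  cases f; cases g
  simp only at hd h2
  subst hd; subst h2; rfl

/-- A concave function that is bounded below on a compact convex set is bounded above. -/
theorem bddAbove (f : ConcaveFn n) : BddAbove (f '' (f.dom : Set (Fin n → ℝ))) := by
  obtain ⟨m, hm⟩ := f.bddBelow
  obtain ⟨x₀, hx₀⟩ := f.dom.nonempty.intrinsicInterior f.dom.convex
  obtain ⟨⟨x₁, hx₁⟩, hint, rfl⟩ := mem_intrinsicInterior.1 hx₀
  rw [mem_interior_iff_mem_nhds, Metric.mem_nhds_iff] at hint
  obtain ⟨δ, hδ, hball⟩ := hint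
  obtain ⟨D, hD⟩ := f.dom.isCompact.isBounded.subset_closedBall x₁
  have hx₁Q : x₁ ∈ (f.dom : Set (Fin n → ℝ)) := by
    have := hball (Metric.mem_ball_self hδ)
    simpa using this
  have hD0 : 0 ≤ D := by
    have := hD hx₁Q
    simpa using this
  set e : ℝ := δ / (2 * (D + 1)) with he
  have hepos : 0 < e := by positivity
  have heD : e * D < δ := by
    rw [he, div_mul_eq_mul_div, div_lt_iff₀ (by positivity)]
    nlinarith
  refine ⟨((1 + e) * f x₁ - m) / e, ?_⟩
  rintro _ ⟨x, hx, rfl⟩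
  have hpA : AffineMap.lineMap x₁ x (-e) ∈ affineSpan ℝ (f.dom : Set (Fin n → ℝ)) :=
    AffineMap.lineMap_mem _ hx₁ (subset_affineSpan ℝ _ hx)
  have hdist : dist x x₁ ≤ D := hD hx
  have hpQ : AffineMap.lineMap x₁ x (-e) ∈ (f.dom : Set (Fin n → ℝ)) := by
    have : (⟨AffineMap.lineMap x₁ x (-e), hpA⟩ : affineSpan ℝ (f.dom : Set (Fin n → ℝ))) ∈
        Metric.ball (⟨x₁, hx₁⟩ : affineSpan ℝ (f.dom : Set (Fin n → ℝ))) δ := by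
      rw [Metric.mem_ball, Subtype.dist_eq]
      simp only [dist_lineMap_left, norm_neg, Real.norm_eq_abs, abs_of_pos hepos]
      rw [dist_comm x₁ x]
      nlinarith
    exact hball this
  have hc := f.concaveOn.2 hpQ hx (show 0 ≤ 1 / (1 + e) by positivity)
    (show 0 ≤ e / (1 + e) by positivity) (by field_simp)
  have hpt : (1 / (1 + e)) • (AffineMap.lineMap x₁ x (-e) : Fin n → ℝ) + (e / (1 + e)) • x
      = x₁ := by
    ext i
    simp [AffineMap.lineMap_apply]
    field_simp
    ring
  rw [hpt] at hc
  have hmp := hm ⟨_, hpQ, rfl⟩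
  simp only [smul_eq_mul] at hc
  rw [le_div_iff₀ hepos]
  have h1 : (1 + e) * f x₁ ≥ f (AffineMap.lineMap x₁ x (-e)) + e * f x := by
    have := mul_le_mul_of_nonneg_left hc (by positivity : 0 ≤ 1 + e)
    have h2 : (1 + e) * (1 / (1 + e) * f (AffineMap.lineMap x₁ x (-e)) + e / (1 + e) * f x)
        = f (AffineMap.lineMap x₁ x (-e)) + e * f x := by field_simp
    linarith
  nlinarith

/-- The values `f y + g z` over the decompositions `x = y + z` with `y ∈ Q`, `z ∈ R`. -/
def splitValues (f g : ConcaveFn n) (x : Fin n → ℝ) : Set ℝ :=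
  {t | ∃ y ∈ f.dom, ∃ z ∈ g.dom, y + z = x ∧ f y + g z = t}

theorem splitValues_bddAbove (f g : ConcaveFn n) (x : Fin n → ℝ) :
    BddAbove (splitValues f g x) := by
  obtain ⟨A, hA⟩ := f.bddAbove
  obtain ⟨B, hB⟩ := g.bddAbove
  refine ⟨A + B, ?_⟩
  rintro _ ⟨y, hy, z, hz, -, rfl⟩
  exact add_le_add (hA ⟨y, hy, rfl⟩) (hB ⟨z, hz, rfl⟩)

theorem splitValues_nonempty (f g : ConcaveFn n) {x : Fin n → ℝ} (hx : x ∈ f.dom + g.dom) :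
    (splitValues f g x).Nonempty := by
  obtain ⟨y, hy, z, hz, rfl⟩ := hx
  exact ⟨_, y, hy, z, hz, rfl, rfl⟩

theorem lt_sSup_splitValues (f g : ConcaveFn n) {x : Fin n → ℝ} (hx : x ∈ f.dom + g.dom) {r : ℝ} :
    r < sSup (splitValues f g x) ↔
      ∃ y ∈ f.dom, ∃ z ∈ g.dom, y + z = x ∧ r < f y + g z := by
  rw [lt_csSup_iff (splitValues_bddAbove f g x) (splitValues_nonempty f g hx)]
  constructor
  · rintro ⟨_, ⟨y, hy, z, hz, h, rfl⟩, hr⟩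
    exact ⟨y, hy, z, hz, h, hr⟩
  · rintro ⟨y, hy, z, hz, h, hr⟩
    exact ⟨_, ⟨y, hy, z, hz, h, rfl⟩, hr⟩

/-- The sup-convolution `f ⊞ g : Q + R → ℝ`,
`x ↦ sup {f y + g z | y ∈ Q, z ∈ R, y + z = x}`, on the Minkowski sum `Q + R`.
Off `Q + R` the supremum is over the empty set, hence `0`. -/
def supConv (f g : ConcaveFn n) : ConcaveFn n where
  dom := f.dom + g.dom
  toFun x := sSup (splitValues f g x)
  concaveOn := by
    refine ⟨(f.dom + g.dom).convex, ?_⟩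
    intro x hx y hy a b ha hb hab
    have hxy : a • x + b • y ∈ f.dom + g.dom := (f.dom + g.dom).convex hx hy ha hb hab
    simp only [smul_eq_mul]
    refine le_of_forall_pos_sub_le fun ε hε => ?_
    obtain ⟨x₁, hx₁, x₂, hx₂, rfl, h1⟩ :=
      (lt_sSup_splitValues f g hx).1 (sub_lt_self _ hε)
    obtain ⟨y₁, hy₁, y₂, hy₂, rfl, h2⟩ :=
      (lt_sSup_splitValues f g hy).1 (sub_lt_self _ hε)
    have hf := f.concaveOn.2 hx₁ hy₁ ha hb hab
    have hg := g.concaveOn.2 hx₂ hy₂ ha hb hab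
    have hle := le_csSup (splitValues_bddAbove f g (a • (x₁ + x₂) + b • (y₁ + y₂)))
      ⟨a • x₁ + b • y₁, f.dom.convex hx₁ hy₁ ha hb hab, a • x₂ + b • y₂,
        g.dom.convex hx₂ hy₂ ha hb hab, by simp only [smul_add]; abel, rfl⟩
    simp only [smul_eq_mul] at hf hg
    have h1' := mul_le_mul_of_nonneg_left h1.le ha
    have h2' := mul_le_mul_of_nonneg_left h2.le hb
    have : ε = a * ε + b * ε := by rw [← add_mul, hab, one_mul]
    linarith
  bddBelow := by
    obtain ⟨A, hA⟩ := f.bddBelow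
    obtain ⟨B, hB⟩ := g.bddBelow
    refine ⟨A + B, ?_⟩
    rintro _ ⟨_, ⟨y, hy, z, hz, rfl⟩, rfl⟩
    exact (add_le_add (hA ⟨y, hy, rfl⟩) (hB ⟨z, hz, rfl⟩)).trans
      (le_csSup (splitValues_bddAbove f g _) ⟨y, hy, z, hz, rfl, rfl⟩)
  toFun_off x hx := by
    have : splitValues f g x = ∅ := by
      rw [Set.eq_empty_iff_forall_notMem]
      rintro _ ⟨y, hy, z, hz, rfl, -⟩
      exact hx ⟨y, hy, z, hz, rfl⟩
    simp only [this, Real.sSup_empty]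

/-- The zero function on the one-point set `{0}`, which is neutral for `⊞`. -/
def zeroFn : ConcaveFn n where
  dom := 0
  toFun _ := 0
  concaveOn := concaveOn_const 0 (0 : ConvexBody (Fin n → ℝ)).convex
  bddBelow := ⟨0, by rintro _ ⟨_, _, rfl⟩; exact le_rfl⟩
  toFun_off _ _ := rfl

/-- `f + g` denotes the sup-convolution `f ⊞ g` (not the pointwise sum). -/
instance : Add (ConcaveFn n) := ⟨supConv⟩

instance : Zero (ConcaveFn n) := ⟨zeroFn⟩

theorem dom_add (f g : ConcaveFn n) : (f + g).dom = f.dom + g.dom := rfl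

theorem add_apply (f g : ConcaveFn n) (x : Fin n → ℝ) : (f + g) x = sSup (splitValues f g x) := rfl

theorem lt_add_apply (f g : ConcaveFn n) {x : Fin n → ℝ} (hx : x ∈ f.dom + g.dom) {r : ℝ} :
    r < (f + g) x ↔ ∃ y ∈ f.dom, ∃ z ∈ g.dom, y + z = x ∧ r < f y + g z :=
  lt_sSup_splitValues f g hx

protected theorem add_comm' (f g : ConcaveFn n) : f + g = g + f := by
  refine ext_of (add_comm f.dom g.dom) fun x _ => ?_
  rw [add_apply, add_apply]
  congr 1
  ext t
  constructor <;> rintro ⟨y, hy, z, hz, h, h'⟩ <;>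
    exact ⟨z, hz, y, hy, by rw [add_comm, h], by rw [add_comm, h']⟩

protected theorem add_assoc' (f g h : ConcaveFn n) : f + g + h = f + (g + h) := by
  refine ext_of (add_assoc f.dom g.dom h.dom) fun x hx => ?_
  have hx' : x ∈ f.dom + (g + h).dom := by
    have : x ∈ f.dom + g.dom + h.dom := hx
    rwa [add_assoc] at this
  refine eq_of_forall_lt_iff fun r => ?_
  rw [lt_add_apply (f + g) h hx, lt_add_apply f (g + h) hx']
  constructor
  · rintro ⟨u, hu, w, hw, rfl, hr⟩
    obtain ⟨y, hy, z, hz, rfl, hr'⟩ := (lt_add_apply f g hu).1 (sub_lt_iff_lt_add.2 hr)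
    have hzw : z + w ∈ g.dom + h.dom := ⟨z, hz, w, hw, rfl⟩
    refine ⟨y, hy, z + w, hzw, (add_assoc _ _ _).symm, ?_⟩
    have := le_csSup (splitValues_bddAbove g h (z + w)) ⟨z, hz, w, hw, rfl, rfl⟩
    rw [← add_apply] at this
    linarith
  · rintro ⟨y, hy, u, hu, rfl, hr⟩
    obtain ⟨z, hz, w, hw, rfl, hr'⟩ := (lt_add_apply g h hu).1 (sub_lt_iff_lt_add'.2 hr)
    have hyz : y + z ∈ f.dom + g.dom := ⟨y, hy, z, hz, rfl⟩
    refine ⟨y + z, hyz, w, hw, add_assoc _ _ _, ?_⟩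
    have := le_csSup (splitValues_bddAbove f g (y + z)) ⟨y, hy, z, hz, rfl, rfl⟩
    rw [← add_apply] at this
    linarith

protected theorem add_zero' (f : ConcaveFn n) : f + 0 = f := by
  refine ext_of (add_zero f.dom) fun x hx => ?_
  have hx' : x ∈ f.dom := by
    have : x ∈ f.dom + 0 := hx
    rwa [add_zero] at this
  have : splitValues f 0 x = {f x} := by
    ext t
    constructor
    · rintro ⟨y, hy, z, hz, rfl, rfl⟩
      have hz0 : z = 0 := hz
      subst hz0
      simp only [add_zero, Set.mem_singleton_iff]
      exact add_zero (f y)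
    · rintro rfl
      exact ⟨x, hx', 0, rfl, add_zero x, add_zero (f x)⟩
  rw [add_apply, this, csSup_singleton]

/-- Concave functions form a commutative semigroup (with neutral element) under `⊞`; in
particular `∑ i ∈ S, f i` is the iterated sup-convolution of the `f i`, `i ∈ S`, defined on the
Minkowski sum of their domains. -/
instance : AddCommMonoid (ConcaveFn n) where
  add_assoc := ConcaveFn.add_assoc'
  zero_add f := by rw [ConcaveFn.add_comm', ConcaveFn.add_zero']
  add_zero := ConcaveFn.add_zero'
  add_comm := ConcaveFn.add_comm'
  nsmul := nsmulRec

/-- The integral `∫_Q f dx₁ ⋯ dxₙ` over the domain `Q` of `f`. -/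
def integral (f : ConcaveFn n) : ℝ := ∫ x in (f.dom : Set (Fin n → ℝ)), f x

/-- `Q_{f,μ} = Conv(Graph(f) ∪ Q × {μ}) ⊆ ℝⁿ⁺¹`; the last coordinate of `ℝⁿ⁺¹` is the value. -/
def roofBody (f : ConcaveFn n) (μ : ℝ) : Set (Fin (n + 1) → ℝ) :=
  convexHull ℝ
    ({p | ∃ x ∈ f.dom, p = Fin.snoc (α := fun _ => ℝ) x (f x)} ∪
      {p | ∃ x ∈ f.dom, p = Fin.snoc (α := fun _ => ℝ) x μ})

end ConcaveFn

/-- The mixed integral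
`MI(f₀, …, fₙ) = ∑_{j=0}^{n} (-1)^{n-j} ∑_{i₀<⋯<i_j} ∫_{Q_{i₀}+⋯+Q_{i_j}} f_{i₀} ⊞ ⋯ ⊞ f_{i_j}`.
The inner index set is `S = {i₀, …, i_j}`, so that `n - j = n + 1 - |S|`. -/
def mixedIntegral {n : ℕ} (f : Fin (n + 1) → ConcaveFn n) : ℝ :=
  ∑ S : Finset (Fin (n + 1)) with S.Nonempty,
    (-1 : ℝ) ^ (n + 1 - S.card) * (∑ i ∈ S, f i).integral

/-- The mixed volume
`MV_n(K₁, …, Kₙ) = ∑_{j=1}^{n} (-1)^{n-j} ∑_{i₁<⋯<i_j} Vol_n(K_{i₁} + ⋯ + K_{i_j})`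
of `n` convex sets in `ℝⁿ` (Minkowski sums). -/
def mixedVolume {n : ℕ} (K : Fin n → Set (Fin n → ℝ)) : ℝ :=
  ∑ S : Finset (Fin n) with S.Nonempty,
    (-1 : ℝ) ^ (n - S.card) * (volume : Measure (Fin n → ℝ)).real (∑ i ∈ S, K i)

end

/-!
# Mixed integrals of concave functions

All claims come down to two facts about the volumes `Vol (∑ i ∈ S, K i)` of the Minkowski sums of a
family of bounded convex sets in `ℝᵐ`: their alternating sum over all `S` vanishes if the family has
more than `m` members (`sum_neg_one_pow_volume_eq_zero`), and it is nonnegative, up to the sign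
`(-1)ᵐ`, if there are exactly `m` of them (`sum_neg_one_pow_volume_nonneg`).

Both are proved without face decompositions or mixed area measures, by a change of variables. For
a solid polytope with vertices in a finite set `V`, the convex function
`logSumExp V x = log ∑ v ∈ V, exp (v ⬝ᵥ x)` has for gradient the mean `gibbsMean V x` of `V` under
Gibbs weights and for Hessian the covariance matrix `gibbsCov V x`. The gradient of a sum of such
functions is injective, and its image is, up to a null set, the Minkowski sum of the polytopes.
Hence the volume of that sum is the integral of the determinant of the sum of the Hessians
(`volume_sum_convexHull`), and the two facts hold already under the integral sign: the alternating
sum of the determinants `det (∑ i ∈ S, H i)` vanishes for more than `m` matrices, and for `m`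
covariance matrices it is a combination of squares with nonnegative coefficients
(`sum_neg_one_pow_det_sum_eq_zero`, `sum_neg_one_pow_det_sum_nonneg`). General bounded convex sets
are limits of solid polytopes from outside.

The passage to functions is the identity `∫ f = Vol (hypograph f c) + c Vol (dom f)` for `c ≤ f`,
together with the fact that sup-convolution adds hypographs up to a null set
(`ConcaveFn.integral_sum`). In polarized form (`alternatingSum_integral`) it gives the formula with
mixed volumes, hence nonnegativity by taking `c = 0`. It also shows that the alternating sum of the
integrals over `n + 2` functions vanishes, which is additivity in each variable
(`alternatingSum_update_add`). On the diagonal, the integral is homogeneous of degree `n + 1`, and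
the `(n + 1)`-st difference of `k ↦ k ^ (n + 1)` is `(n + 1)!`.
-/

/-! ### Alternating sums over subsets -/

theorem sum_superset_neg_one_pow_card {ι : Type*} [Fintype ι] [DecidableEq ι] (T : Finset ι) :
    ∑ S : Finset ι with T ⊆ S, (-1 : ℝ) ^ S.card =
      if T = Finset.univ then (-1 : ℝ) ^ Fintype.card ι else 0 := by
  have h : ∑ S : Finset ι with T ⊆ S, (-1 : ℝ) ^ S.card =
      ∑ U ∈ (Tᶜ).powerset, (-1 : ℝ) ^ T.card * (-1 : ℝ) ^ U.card := by
    refine Finset.sum_bij' (fun S _ => S \ T) (fun U _ => T ∪ U) ?_ ?_ ?_ ?_ ?_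
    · intro S _
      simp only [Finset.mem_powerset]
      intro x hx
      simp only [Finset.mem_sdiff] at hx
      simpa using hx.2
    · intro U _
      simp
    · intro S hS
      simp only [Finset.mem_filter] at hS
      exact Finset.union_sdiff_of_subset hS.2
    · intro U hU
      simp only [Finset.mem_powerset] at hU
      refine Finset.union_sdiff_cancel_left ?_
      exact (Finset.disjoint_left.2 fun x hx hU' => by simpa [hx] using hU hU')
    · intro S hS
      simp only [Finset.mem_filter] at hS
      rw [← pow_add, add_comm, Finset.card_sdiff_add_card_eq_card hS.2]
  rw [h, ← Finset.mul_sum]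
  have h2 := Finset.sum_powerset_neg_one_pow_card (x := Tᶜ)
  have h3 : ∑ U ∈ (Tᶜ).powerset, (-1 : ℝ) ^ U.card = if Tᶜ = ∅ then 1 else 0 := by
    exact_mod_cast congrArg (Int.cast : ℤ → ℝ) h2
  rw [h3]
  simp only [Finset.compl_eq_empty_iff]
  split_ifs with hT
  · simp [hT]
  · simp

/-! ### Mixed discriminants -/

section Det

variable {ι k : Type*} [Fintype ι] [DecidableEq ι] [Fintype k] [DecidableEq k]

/-- By multilinearity of the determinant in the rows, the alternating sum of the determinants of
the partial sums of `H` keeps only the choices of rows in which every `H i` contributes a row. -/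
theorem sum_neg_one_pow_det_sum (H : ι → Matrix k k ℝ) :
    ∑ S : Finset ι, (-1 : ℝ) ^ S.card * (∑ i ∈ S, H i).det =
      (-1 : ℝ) ^ Fintype.card ι *
        ∑ r : k → ι with Function.Surjective r, (Matrix.of fun a => H (r a) a).det := by
  have h1 : ∀ S : Finset ι, (∑ i ∈ S, H i).det =
      ∑ r : k → ι, if Finset.univ.image r ⊆ S then (Matrix.of fun a => H (r a) a).det else 0 := by
    intro S
    have e : (∑ i ∈ S, H i) = fun a => ∑ i ∈ S, H i a := by
      ext a b; simp [Matrix.sum_apply]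
    have := (Matrix.detRowAlternating (n := k) (R := ℝ)).toMultilinearMap.map_sum_finset
      (fun a i => H i a) (fun _ => S)
    rw [← Finset.sum_filter]
    have hS : (Finset.univ.filter fun r : k → ι => Finset.univ.image r ⊆ S) =
        Fintype.piFinset fun _ => S := by
      ext r
      simp [Finset.subset_iff]
    rw [hS, e]
    exact this
  simp_rw [h1, Finset.mul_sum]
  rw [Finset.sum_comm, Finset.sum_filter]
  refine Finset.sum_congr rfl fun r _ => ?_
  have := sum_superset_neg_one_pow_card (Finset.univ.image r)
  rw [Finset.sum_filter] at this
  have h2 : (Finset.univ.image r = Finset.univ) ↔ Function.Surjective r := by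
    rw [Finset.eq_univ_iff_forall]
    simp [Function.Surjective]
  simp_rw [h2] at this
  have h3 : ∀ S : Finset ι, ((-1 : ℝ) ^ S.card * if Finset.univ.image r ⊆ S then
      (Matrix.of fun a => H (r a) a).det else 0) = (if Finset.univ.image r ⊆ S then
      (-1 : ℝ) ^ S.card else 0) * (Matrix.of fun a => H (r a) a).det := by
    intro S; split_ifs <;> simp
  simp_rw [h3, ← Finset.sum_mul]
  rw [this]
  split_ifs <;> simp

theorem sum_neg_one_pow_det_sum_eq_zero (H : ι → Matrix k k ℝ)
    (h : Fintype.card k < Fintype.card ι) :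
    ∑ S : Finset ι, (-1 : ℝ) ^ S.card * (∑ i ∈ S, H i).det = 0 := by
  rw [sum_neg_one_pow_det_sum, Finset.sum_eq_zero, mul_zero]
  intro r hr
  exact absurd (Fintype.card_le_of_surjective r (Finset.mem_filter.1 hr).2) (not_le.2 h)

/-- The mixed discriminant of matrices `∑ v, w v • a v (a v)ᵀ` with weights `w ≥ 0` is nonnegative:
it is a combination with nonnegative coefficients of squares of determinants. -/
theorem sum_neg_one_pow_det_sum_nonneg {κ : Type*} [DecidableEq κ] (V : k → Finset κ)
    (w : k → κ → ℝ) (hw : ∀ i, ∀ v ∈ V i, 0 ≤ w i v) (a : k → κ → k → ℝ) :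
    0 ≤ (-1 : ℝ) ^ Fintype.card k * ∑ S : Finset k, (-1 : ℝ) ^ S.card *
      (∑ i ∈ S, ∑ v ∈ V i, w i v • Matrix.vecMulVec (a i v) (a i v)).det := by
  rw [sum_neg_one_pow_det_sum (fun i => ∑ v ∈ V i, w i v • Matrix.vecMulVec (a i v) (a i v)),
    ← mul_assoc, ← pow_add, Even.neg_one_pow ⟨_, rfl⟩, one_mul]
  set H : k → Matrix k k ℝ := fun i => ∑ v ∈ V i, w i v • Matrix.vecMulVec (a i v) (a i v)
  have hs : ∑ r : k → k with Function.Surjective r, (Matrix.of fun b => H (r b) b).det =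
      ∑ σ : Equiv.Perm k, (Matrix.of fun b => H (σ b) b).det := by
    symm
    refine Finset.sum_bij (fun σ _ => (σ : k → k)) ?_ ?_ ?_ ?_
    · intro σ _
      simpa using σ.surjective
    · intro σ _ τ _ h
      exact DFunLike.coe_injective h
    · intro r hr
      have hr' := (Finset.mem_filter.1 hr).2
      exact ⟨Equiv.ofBijective r (Finite.surjective_iff_bijective.1 hr'), Finset.mem_univ _, rfl⟩
    · intro σ _
      rfl
  have hrow : ∀ σ : Equiv.Perm k, (Matrix.of fun b => H (σ b) b).det =
      ∑ v ∈ Fintype.piFinset V, (∏ i, w i (v i)) *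
        (((Equiv.Perm.sign σ : ℤ) : ℝ) * ∏ i, (Matrix.of fun i => a i (v i)) (σ i) i) *
        (Matrix.of fun i => a i (v i)).det := by
    intro σ
    have h1 : (Matrix.of fun b => H (σ b) b) =
        (Matrix.of fun i => H i (σ⁻¹ i)).submatrix σ id := by
      ext b c; simp
    rw [h1, Matrix.det_permute]
    have h2 : (Matrix.of fun i => H i (σ⁻¹ i)) =
        fun i => ∑ v ∈ V i, (w i v * a i v (σ⁻¹ i)) • a i v := by
      ext i c
      simp [H, Matrix.sum_apply, Matrix.vecMulVec_apply, mul_assoc]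
    have h3 := (Matrix.detRowAlternating (n := k) (R := ℝ)).toMultilinearMap.map_sum_finset
      (fun i v => (w i v * a i v (σ⁻¹ i)) • a i v) V
    have h4 : (Matrix.of fun i => H i (σ⁻¹ i)).det = ∑ v ∈ Fintype.piFinset V,
        (∏ i, (w i (v i) * a i (v i) (σ⁻¹ i))) * (Matrix.of fun i => a i (v i)).det := by
      rw [h2]
      refine h3.trans (Finset.sum_congr rfl fun v _ => ?_)
      rw [MultilinearMap.map_smul_univ]
      rfl
    rw [h4, Finset.mul_sum]
    refine Finset.sum_congr rfl fun v _ => ?_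
    have h5 : ∏ i, a i (v i) (σ⁻¹ i) = ∏ i, (Matrix.of fun i => a i (v i)) (σ i) i := by
      rw [← Equiv.prod_comp σ]
      simp
    rw [Finset.prod_mul_distrib, h5]
    ring
  rw [hs, Finset.sum_congr rfl fun σ _ => hrow σ, Finset.sum_comm]
  refine Finset.sum_nonneg fun v hv => ?_
  rw [← Finset.sum_mul, ← Finset.mul_sum]
  have hd : ∑ σ : Equiv.Perm k, (((Equiv.Perm.sign σ : ℤ) : ℝ) *
      ∏ i, (Matrix.of fun i => a i (v i)) (σ i) i) = (Matrix.of fun i => a i (v i)).det := by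
    rw [Matrix.det_apply']
  rw [hd, mul_assoc]
  refine mul_nonneg (Finset.prod_nonneg fun i _ => hw i _ (Fintype.mem_piFinset.1 hv i))
    (mul_self_nonneg _)

end Det

/-! ### The moment map of a polytope -/

section Gibbs

variable {m : ℕ}

/-- The linear functional `x ↦ v ⬝ᵥ x` as a continuous linear map. -/
noncomputable def dotCLM (v : Fin m → ℝ) : (Fin m → ℝ) →L[ℝ] ℝ :=
  LinearMap.toContinuousLinearMap (dotProductBilin ℝ ℝ v)

@[simp]
theorem dotCLM_apply (v x : Fin m → ℝ) : dotCLM v x = v ⬝ᵥ x := rfl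

/-- The convex function `x ↦ log ∑ v ∈ V, exp (v ⬝ᵥ x)`, a smoothing of the support function of the
polytope with vertices in `V`. -/
noncomputable def logSumExp (V : Finset (Fin m → ℝ)) (x : Fin m → ℝ) : ℝ :=
  Real.log (∑ v ∈ V, Real.exp (v ⬝ᵥ x))

/-- The Gibbs weight `exp (v ⬝ᵥ x) / ∑ u ∈ V, exp (u ⬝ᵥ x)` of `v ∈ V`. -/
noncomputable def gibbsWeight (V : Finset (Fin m → ℝ)) (x v : Fin m → ℝ) : ℝ :=
  Real.exp (v ⬝ᵥ x - logSumExp V x)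

/-- The mean of `V` under the Gibbs weights; this is the gradient of `logSumExp V` at `x`. -/
noncomputable def gibbsMean (V : Finset (Fin m → ℝ)) (x : Fin m → ℝ) : Fin m → ℝ :=
  ∑ v ∈ V, gibbsWeight V x v • v

/-- The covariance matrix of `V` under the Gibbs weights; this is the Hessian of `logSumExp V`. -/
noncomputable def gibbsCov (V : Finset (Fin m → ℝ)) (x : Fin m → ℝ) : Matrix (Fin m) (Fin m) ℝ :=
  ∑ v ∈ V, gibbsWeight V x v •
    Matrix.vecMulVec (v - gibbsMean V x) (v - gibbsMean V x)

variable {V : Finset (Fin m → ℝ)}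

theorem gibbsWeight_pos (x v : Fin m → ℝ) : 0 < gibbsWeight V x v := Real.exp_pos _

theorem nonempty_of_interior_convexHull
    (hV : (interior (convexHull ℝ (V : Set (Fin m → ℝ)))).Nonempty) : V.Nonempty := by
  by_contra h0
  rw [Finset.not_nonempty_iff_eq_empty] at h0
  simp [h0] at hV

theorem sum_exp_pos (hV : V.Nonempty) (x : Fin m → ℝ) : 0 < ∑ v ∈ V, Real.exp (v ⬝ᵥ x) :=
  Finset.sum_pos (fun _ _ => Real.exp_pos _) hV

theorem gibbsWeight_eq (hV : V.Nonempty) (x v : Fin m → ℝ) :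
    gibbsWeight V x v = Real.exp (v ⬝ᵥ x) / ∑ u ∈ V, Real.exp (u ⬝ᵥ x) := by
  rw [gibbsWeight, Real.exp_sub, logSumExp, Real.exp_log (sum_exp_pos hV x)]

theorem sum_gibbsWeight (hV : V.Nonempty) (x : Fin m → ℝ) : ∑ v ∈ V, gibbsWeight V x v = 1 := by
  simp_rw [gibbsWeight_eq hV, ← Finset.sum_div]
  exact div_self (sum_exp_pos hV x).ne'

theorem gibbsMean_mem (hV : V.Nonempty) (x : Fin m → ℝ) :
    gibbsMean V x ∈ convexHull ℝ (V : Set (Fin m → ℝ)) :=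
  (convex_convexHull ℝ _).sum_mem (fun v _ => (gibbsWeight_pos x v).le) (sum_gibbsWeight hV x)
    fun _ hv => subset_convexHull ℝ _ hv

theorem hasFDerivAt_logSumExp (hV : V.Nonempty) (x : Fin m → ℝ) :
    HasFDerivAt (logSumExp V) (dotCLM (gibbsMean V x)) x := by
  have h1 : ∀ v ∈ V, HasFDerivAt (fun y => Real.exp (v ⬝ᵥ y)) (Real.exp (v ⬝ᵥ x) • dotCLM v) x :=
    fun v _ => ((dotCLM v).hasFDerivAt (x := x)).exp
  have h2 := (HasFDerivAt.fun_sum h1).log (sum_exp_pos hV x).ne'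
  refine h2.congr_fderiv ?_
  ext1 w
  simp only [smul_apply, sum_apply, dotCLM_apply,
    smul_eq_mul, gibbsMean, sum_dotProduct, smul_dotProduct, gibbsWeight_eq hV, Finset.mul_sum]
  refine Finset.sum_congr rfl fun v _ => ?_
  ring

theorem hasFDerivAt_gibbsWeight (hV : V.Nonempty) (x v : Fin m → ℝ) :
    HasFDerivAt (fun y => gibbsWeight V y v)
      (gibbsWeight V x v • dotCLM (v - gibbsMean V x)) x := by
  have h := (((dotCLM v).hasFDerivAt (x := x)).fun_sub (hasFDerivAt_logSumExp hV x)).exp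
  refine h.congr_fderiv ?_
  ext1 w
  simp [gibbsWeight, sub_dotProduct]

theorem hasFDerivAt_gibbsMean (hV : V.Nonempty) (x : Fin m → ℝ) :
    HasFDerivAt (gibbsMean V)
      (LinearMap.toContinuousLinearMap (Matrix.toLin' (gibbsCov V x))) x := by
  have h1 : ∀ v ∈ V, HasFDerivAt (fun y => gibbsWeight V y v • v)
      ((gibbsWeight V x v • dotCLM (v - gibbsMean V x)).smulRight v) x :=
    fun v _ => (hasFDerivAt_gibbsWeight hV x v).smul_const v
  refine (HasFDerivAt.fun_sum h1).congr_fderiv ?_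
  ext1 w
  -- the weighted deviations from the mean sum to zero
  have h0 : ∑ v ∈ V, gibbsWeight V x v • (v - gibbsMean V x) = 0 := by
    simp_rw [smul_sub, Finset.sum_sub_distrib, ← Finset.sum_smul, sum_gibbsWeight hV x, one_smul]
    exact sub_self _
  have h2 : ∑ v ∈ V, gibbsWeight V x v * ((v - gibbsMean V x) ⬝ᵥ w) = 0 := by
    have := congrArg (fun u => u ⬝ᵥ w) h0
    simpa [sum_dotProduct, smul_dotProduct] using this
  simp only [sum_apply, ContinuousLinearMap.smulRight_apply,
    smul_apply, dotCLM_apply, smul_eq_mul,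
    LinearMap.coe_toContinuousLinearMap', Matrix.toLin'_apply, gibbsCov, Matrix.sum_mulVec,
    Matrix.smul_mulVec, Matrix.vecMulVec_mulVec]
  have h3 : ∑ v ∈ V, (gibbsWeight V x v * ((v - gibbsMean V x) ⬝ᵥ w)) • gibbsMean V x = 0 := by
    rw [← Finset.sum_smul, h2, zero_smul]
  rw [← sub_zero (∑ v ∈ V, (gibbsWeight V x v * ((v - gibbsMean V x) ⬝ᵥ w)) • v), ← h3,
    ← Finset.sum_sub_distrib]
  refine Finset.sum_congr rfl fun v _ => ?_
  ext c
  simp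
  ring

theorem continuous_gibbsMean (hV : V.Nonempty) : Continuous (gibbsMean V) :=
  continuous_iff_continuousAt.2 fun x => (hasFDerivAt_gibbsMean hV x).continuousAt

theorem continuous_gibbsCov (hV : V.Nonempty) : Continuous (gibbsCov V) := by
  have hm := continuous_gibbsMean hV
  have hw : ∀ v, Continuous fun x => gibbsWeight V x v := fun v =>
    continuous_iff_continuousAt.2 fun x => (hasFDerivAt_gibbsWeight hV x v).continuousAt
  unfold gibbsCov
  refine continuous_finsetSum _ fun v _ => (hw v).smul ?_
  exact Continuous.matrix_vecMulVec (by fun_prop) (by fun_prop)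

theorem posSemidef_gibbsCov (x : Fin m → ℝ) : (gibbsCov V x).PosSemidef :=
  Matrix.posSemidef_sum _ fun v _ =>
    (by simpa using Matrix.posSemidef_vecMulVec_self_star (v - gibbsMean V x) :
      (Matrix.vecMulVec (v - gibbsMean V x) (v - gibbsMean V x)).PosSemidef).smul
        (gibbsWeight_pos x v).le

theorem dotProduct_le_logSumExp {y : Fin m → ℝ}
    (hy : y ∈ convexHull ℝ (V : Set (Fin m → ℝ))) (x : Fin m → ℝ) : y ⬝ᵥ x ≤ logSumExp V x := by
  have hconv : Convex ℝ {y : Fin m → ℝ | y ⬝ᵥ x ≤ logSumExp V x} := by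
    intro a ha b hb s t hs ht hst
    simp only [Set.mem_ofPred_eq, add_dotProduct, smul_dotProduct, smul_eq_mul] at *
    calc s * (a ⬝ᵥ x) + t * (b ⬝ᵥ x) ≤ s * logSumExp V x + t * logSumExp V x := by gcongr
      _ = logSumExp V x := by rw [← add_mul, hst, one_mul]
  refine convexHull_min (fun v hv => ?_) hconv hy
  simp only [Set.mem_ofPred_eq]
  rw [logSumExp, ← Real.log_exp (v ⬝ᵥ x)]
  refine Real.log_le_log (Real.exp_pos _) ?_
  exact Finset.single_le_sum (f := fun v => Real.exp (v ⬝ᵥ x)) (fun _ _ => (Real.exp_pos _).le) hv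

/-- The pairing that expresses monotonicity is the symmetrized relative entropy of the Gibbs weights
at `x` and `y`. -/
theorem gibbsMean_sub_dotProduct (hV : V.Nonempty) (x y : Fin m → ℝ) :
    (gibbsMean V x - gibbsMean V y) ⬝ᵥ (x - y) = ∑ v ∈ V,
      (gibbsWeight V x v - gibbsWeight V y v) *
        (Real.log (gibbsWeight V x v) - Real.log (gibbsWeight V y v)) := by
  have h : ∀ v ∈ V, (gibbsWeight V x v - gibbsWeight V y v) *
        (Real.log (gibbsWeight V x v) - Real.log (gibbsWeight V y v)) =
      (gibbsWeight V x v - gibbsWeight V y v) * (v ⬝ᵥ (x - y)) -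
        (gibbsWeight V x v - gibbsWeight V y v) * (logSumExp V x - logSumExp V y) := by
    intro v _
    rw [gibbsWeight, gibbsWeight, Real.log_exp, Real.log_exp, dotProduct_sub]
    ring
  rw [Finset.sum_congr rfl h, Finset.sum_sub_distrib, ← Finset.sum_mul, Finset.sum_sub_distrib,
    sum_gibbsWeight hV, sum_gibbsWeight hV, sub_self, zero_mul, sub_zero]
  simp only [gibbsMean, ← Finset.sum_sub_distrib, ← sub_smul, sum_dotProduct, smul_dotProduct,
    smul_eq_mul]

theorem sub_mul_log_sub_log_nonneg {a b : ℝ} (ha : 0 < a) (hb : 0 < b) :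
    0 ≤ (a - b) * (Real.log a - Real.log b) := by
  rcases le_total a b with h | h
  · exact mul_nonneg_of_nonpos_of_nonpos (sub_nonpos.2 h)
      (sub_nonpos.2 (Real.log_le_log ha h))
  · exact mul_nonneg (sub_nonneg.2 h) (sub_nonneg.2 (Real.log_le_log hb h))

theorem gibbsMean_sub_dotProduct_nonneg (hV : V.Nonempty) (x y : Fin m → ℝ) :
    0 ≤ (gibbsMean V x - gibbsMean V y) ⬝ᵥ (x - y) := by
  rw [gibbsMean_sub_dotProduct hV]
  exact Finset.sum_nonneg fun v _ =>
    sub_mul_log_sub_log_nonneg (gibbsWeight_pos x v) (gibbsWeight_pos y v)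

/-- The gradient of `logSumExp V` is strictly monotone as soon as `V` spans a solid polytope. -/
theorem eq_of_gibbsMean_sub_dotProduct_eq_zero
    (hV : (interior (convexHull ℝ (V : Set (Fin m → ℝ)))).Nonempty) {x y : Fin m → ℝ}
    (h : (gibbsMean V x - gibbsMean V y) ⬝ᵥ (x - y) = 0) : x = y := by
  have hne : V.Nonempty := nonempty_of_interior_convexHull hV
  rw [gibbsMean_sub_dotProduct hne, Finset.sum_eq_zero_iff_of_nonneg fun v _ =>
    sub_mul_log_sub_log_nonneg (gibbsWeight_pos x v) (gibbsWeight_pos y v)] at h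
  -- equality of the weights forces `v ⬝ᵥ (x - y)` to take a constant value `c` on `V`
  set c := logSumExp V x - logSumExp V y
  have hc : ∀ v ∈ V, v ⬝ᵥ (x - y) = c := by
    intro v hv
    have hlog : Real.log (gibbsWeight V x v) = Real.log (gibbsWeight V y v) := by
      rcases mul_eq_zero.1 (h v hv) with h' | h'
      · rw [sub_eq_zero.1 h']
      · exact sub_eq_zero.1 h'
    rw [gibbsWeight, gibbsWeight, Real.log_exp, Real.log_exp] at hlog
    rw [dotProduct_sub]
    simp only [c]
    linarith
  have hconv : Convex ℝ {u : Fin m → ℝ | u ⬝ᵥ (x - y) = c} := by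
    intro a ha b hb s t _ _ hst
    simp only [Set.mem_ofPred_eq, add_dotProduct, smul_dotProduct, smul_eq_mul] at *
    rw [ha, hb, ← add_mul, hst, one_mul]
  have hall := convexHull_min (s := (V : Set (Fin m → ℝ))) (fun v hv => hc v hv) hconv
  obtain ⟨z, hz⟩ := hV
  have hzc : z ⬝ᵥ (x - y) = c := hall (interior_subset hz)
  -- moving from an interior point in the direction `x - y` keeps the value `c`
  have hnear : ∀ᶠ t : ℝ in nhds 0, z + t • (x - y) ∈ interior (convexHull ℝ (V : Set _)) := by
    have hcont : Continuous fun t : ℝ => z + t • (x - y) := by fun_prop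
    exact hcont.continuousAt.eventually_mem (isOpen_interior.mem_nhds (by simpa using hz))
  obtain ⟨t, ht, ht0⟩ := (hnear.filter_mono nhdsWithin_le_nhds |>.and
    (self_mem_nhdsWithin : Set.Ioi (0 : ℝ) ∈ nhdsWithin 0 (Set.Ioi 0))).exists
  have htc : (z + t • (x - y)) ⬝ᵥ (x - y) = c := hall (interior_subset ht)
  rw [add_dotProduct, hzc, smul_dotProduct, smul_eq_mul, add_eq_left] at htc
  rcases mul_eq_zero.1 htc with h' | h'
  · exact absurd h' (ne_of_gt ht0)
  · exact sub_eq_zero.1 (dotProduct_self_eq_zero.1 h')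

end Gibbs

/-! ### Volumes of Minkowski sums of polytopes -/

section Polytope

variable {m : ℕ} {ι : Type*}

theorem Convex.finsetSum {E : Type*} [AddCommGroup E] [Module ℝ E] {K : ι → Set E} (S : Finset ι)
    (hK : ∀ i ∈ S, Convex ℝ (K i)) : Convex ℝ (∑ i ∈ S, K i) := by
  have h : ∑ i ∈ S, K i = convexHull ℝ (∑ i ∈ S, K i) := by
    rw [convexHull_sum]
    exact Finset.sum_congr rfl fun i hi => (hK i hi).convexHull_eq.symm
  rw [h]
  exact convex_convexHull ℝ _

theorem isBounded_finsetSum {K : ι → Set (Fin m → ℝ)} (S : Finset ι)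
    (hK : ∀ i ∈ S, Bornology.IsBounded (K i)) : Bornology.IsBounded (∑ i ∈ S, K i) := by
  classical
  induction S using Finset.induction_on with
  | empty => exact (Set.finite_singleton (0 : Fin m → ℝ)).isBounded
  | insert i T hi ih =>
    rw [Finset.sum_insert hi]
    exact (hK i (Finset.mem_insert_self i T)).add
      (ih fun j hj => hK j (Finset.mem_insert_of_mem hj))

/-- Every interior point `y` of a Minkowski sum of polytopes is a value of the gradient of
`∑ i, logSumExp (V i)`: the function `x ↦ ∑ i, logSumExp (V i) x - y ⬝ᵥ x` is coercive. -/
theorem interior_sum_convexHull_subset_range (V : ι → Finset (Fin m → ℝ))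
    (hV : ∀ i, (V i).Nonempty) (S : Finset ι) :
    interior (∑ i ∈ S, convexHull ℝ (V i : Set (Fin m → ℝ))) ⊆
      Set.range fun x => ∑ i ∈ S, gibbsMean (V i) x := by
  intro y hy
  obtain ⟨δ, hδ, hball⟩ := Metric.nhds_basis_closedBall.mem_iff.1 (mem_interior_iff_mem_nhds.1 hy)
  set ψ : (Fin m → ℝ) → ℝ := fun x => ∑ i ∈ S, logSumExp (V i) x - y ⬝ᵥ x
  have hψ : ∀ x, HasFDerivAt ψ (∑ i ∈ S, dotCLM (gibbsMean (V i) x) - dotCLM y) x := fun x =>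
    (HasFDerivAt.fun_sum fun i _ => hasFDerivAt_logSumExp (hV i) x).fun_sub
      (dotCLM y).hasFDerivAt
  have hcont : Continuous ψ := continuous_iff_continuousAt.2 fun x => (hψ x).continuousAt
  have hcoer : ∀ x, δ * ‖x‖ ≤ ψ x := by
    intro x
    -- the point `y + δ s` of the polytope, with `s` the sign vector of `x`
    set s : Fin m → ℝ := fun j => (SignType.sign (x j) : ℝ)
    have hs : ‖s‖ ≤ 1 := by
      refine (pi_norm_le_iff_of_nonneg zero_le_one).2 fun j => ?_
      simp only [s]
      rcases SignType.sign (x j) with _ | _ | _ <;> simp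
    have hmem : y + δ • s ∈ ∑ i ∈ S, convexHull ℝ (V i : Set (Fin m → ℝ)) := by
      refine hball ?_
      rw [Metric.mem_closedBall, dist_eq_norm, add_sub_cancel_left, norm_smul, Real.norm_eq_abs,
        abs_of_pos hδ]
      exact mul_le_of_le_one_right hδ.le hs
    have hsx : ‖x‖ ≤ s ⬝ᵥ x := by
      have hsum : s ⬝ᵥ x = ∑ j, |x j| := by
        simp only [dotProduct, s, sign_mul_self]
      rw [hsum]
      refine (pi_norm_le_iff_of_nonneg (Finset.sum_nonneg fun j _ => abs_nonneg _)).2 fun j => ?_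
      exact Finset.single_le_sum (f := fun j => |x j|) (fun _ _ => abs_nonneg _)
        (Finset.mem_univ j)
    obtain ⟨u, hu, hus⟩ := (Set.mem_finsetSum _ _ _).1 hmem
    have h1 : (y + δ • s) ⬝ᵥ x ≤ ∑ i ∈ S, logSumExp (V i) x := by
      rw [← hus, sum_dotProduct]
      exact Finset.sum_le_sum fun i hi => dotProduct_le_logSumExp (hu hi) x
    rw [add_dotProduct, smul_dotProduct, smul_eq_mul] at h1
    have h2 := mul_le_mul_of_nonneg_left hsx hδ.le
    simp only [ψ]
    linarith
  obtain ⟨x, hx⟩ := hcont.exists_forall_le_of_isBounded 0 (by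
    refine (Metric.isBounded_closedBall (x := (0 : Fin m → ℝ)) (r := ψ 0 / δ)).subset ?_
    intro x hx
    rw [mem_closedBall_zero_iff, le_div_iff₀ hδ, mul_comm]
    exact (hcoer x).trans hx)
  have hmin : IsLocalMin ψ x := Filter.Eventually.of_forall hx
  have h0 := hmin.hasFDerivAt_eq_zero (hψ x)
  refine ⟨x, sub_eq_zero.1 (dotProduct_eq_zero _ fun w => ?_)⟩
  have := DFunLike.congr_fun h0 w
  simpa [sub_dotProduct, sum_dotProduct] using this

/-- The volume of a Minkowski sum of solid polytopes is the integral of the determinant of the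
sum of the corresponding Hessians. The empty sum is the point `0`, with Hessian `0`. -/
theorem volume_sum_convexHull (V : ι → Finset (Fin m → ℝ))
    (hV : ∀ i, (interior (convexHull ℝ (V i : Set (Fin m → ℝ)))).Nonempty) (S : Finset ι) :
    Integrable (fun x => (∑ i ∈ S, gibbsCov (V i) x).det) ∧
      volume.real (∑ i ∈ S, convexHull ℝ (V i : Set (Fin m → ℝ))) =
        ∫ x, (∑ i ∈ S, gibbsCov (V i) x).det := by
  have hne : ∀ i, (V i).Nonempty := fun i => nonempty_of_interior_convexHull (hV i)
  by_cases hS : S = ∅ ∧ 0 < m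
  · obtain ⟨rfl, hm⟩ := hS
    have : Nonempty (Fin m) := ⟨⟨0, hm⟩⟩
    simp [Matrix.det_zero, measureReal_def, ← Set.singleton_zero]
  set P := ∑ i ∈ S, convexHull ℝ (V i : Set (Fin m → ℝ))
  have hP : Convex ℝ P := Convex.finsetSum S fun i _ => convex_convexHull ℝ _
  have hPb : Bornology.IsBounded P :=
    isBounded_finsetSum S fun i _ => isBounded_convexHull.2 (V i).finite_toSet.isBounded
  set G : (Fin m → ℝ) → (Fin m → ℝ) := fun x => ∑ i ∈ S, gibbsMean (V i) x
  set D : (Fin m → ℝ) → Matrix (Fin m) (Fin m) ℝ := fun x => ∑ i ∈ S, gibbsCov (V i) x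
  have hG : ∀ x, HasFDerivAt G (LinearMap.toContinuousLinearMap (Matrix.toLin' (D x))) x := by
    intro x
    refine (HasFDerivAt.fun_sum fun i _ => hasFDerivAt_gibbsMean (hne i) x).congr_fderiv ?_
    simp only [D, map_sum]
  have hinj : Function.Injective G := by
    intro x y hxy
    rcases S.eq_empty_or_nonempty with h | ⟨i, hi⟩
    · have : m = 0 := by
        by_contra hm
        exact hS ⟨h, Nat.pos_of_ne_zero hm⟩
      subst this
      exact Subsingleton.elim _ _
    · have h1 : ∑ i ∈ S, (gibbsMean (V i) x - gibbsMean (V i) y) ⬝ᵥ (x - y) = 0 := by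
        rw [← sum_dotProduct, Finset.sum_sub_distrib, sub_eq_zero.2 hxy, zero_dotProduct]
      rw [Finset.sum_eq_zero_iff_of_nonneg fun i _ =>
        gibbsMean_sub_dotProduct_nonneg (hne i) x y] at h1
      exact eq_of_gibbsMean_sub_dotProduct_eq_zero (hV i) (h1 i hi)
  have hdet : ∀ x, 0 ≤ (D x).det := fun x =>
    (Matrix.posSemidef_sum _ fun i _ => posSemidef_gibbsCov x).det_nonneg
  have hvol : ∫⁻ x, ENNReal.ofReal (D x).det = volume P := by
    have h := lintegral_abs_det_fderiv_eq_addHaar_image volume MeasurableSet.univ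
      (fun x _ => (hG x).hasFDerivWithinAt) hinj.injOn
    simp only [Measure.restrict_univ, LinearMap.det_toContinuousLinearMap, LinearMap.det_toLin',
      Set.image_univ] at h
    rw [lintegral_congr fun x => by rw [← abs_of_nonneg (hdet x)], h]
    refine le_antisymm (measure_mono ?_) ?_
    · rintro _ ⟨x, rfl⟩
      exact (Set.mem_finsetSum _ _ _).2 ⟨_, fun hi => gibbsMean_mem (hne _) x, rfl⟩
    · rw [← measure_congr (interior_ae_eq_of_null_frontier (hP.addHaar_frontier volume))]
      exact measure_mono (interior_sum_convexHull_subset_range V hne S)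
  have hcont : Continuous fun x => (D x).det :=
    (continuous_finsetSum _ fun i _ => continuous_gibbsCov (hne i)).matrix_det
  refine ⟨⟨hcont.aestronglyMeasurable, ?_⟩, ?_⟩
  · rw [hasFiniteIntegral_iff_ofReal (Filter.Eventually.of_forall hdet), hvol]
    exact hPb.measure_lt_top
  · rw [integral_eq_lintegral_of_nonneg_ae (Filter.Eventually.of_forall hdet)
      hcont.aestronglyMeasurable, hvol, measureReal_def]

theorem sum_neg_one_pow_volume_convexHull [Fintype ι] (V : ι → Finset (Fin m → ℝ))
    (hV : ∀ i, (interior (convexHull ℝ (V i : Set (Fin m → ℝ)))).Nonempty) :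
    ∑ S : Finset ι, (-1 : ℝ) ^ S.card *
        volume.real (∑ i ∈ S, convexHull ℝ (V i : Set (Fin m → ℝ))) =
      ∫ x, ∑ S : Finset ι, (-1 : ℝ) ^ S.card * (∑ i ∈ S, gibbsCov (V i) x).det := by
  rw [integral_finsetSum _ fun S _ => (volume_sum_convexHull V hV S).1.const_mul _]
  refine Finset.sum_congr rfl fun S _ => ?_
  rw [integral_const_mul, (volume_sum_convexHull V hV S).2]

end Polytope

/-! ### Alternating sums of volumes of convex sets -/

section ConvexVolume

variable {m : ℕ} {ι : Type*}

/-- Bounded convex sets can be approximated from outside by solid polytopes, simultaneously and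
so closely that the volumes of all their Minkowski sums converge. -/
theorem exists_tendsto_volume_sum_convexHull (K : ι → Set (Fin m → ℝ))
    (hc : ∀ i, Convex ℝ (K i)) (hb : ∀ i, Bornology.IsBounded (K i)) (hn : ∀ i, (K i).Nonempty) :
    ∃ V : ℕ → ι → Finset (Fin m → ℝ),
      (∀ k i, (interior (convexHull ℝ (V k i : Set (Fin m → ℝ)))).Nonempty) ∧
      ∀ S : Finset ι, Filter.Tendsto
        (fun k => volume.real (∑ i ∈ S, convexHull ℝ (V k i : Set (Fin m → ℝ)))) Filter.atTop
        (nhds (volume.real (∑ i ∈ S, K i))) := by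
  have hδ : ∀ k : ℕ, (0 : ℝ) < 1 / ((k : ℝ) + 1) := fun k => by positivity
  have hV : ∀ (k : ℕ) (i : ι), ∃ u : Finset (Fin m → ℝ),
      closure (K i) ⊆ interior (convexHull ℝ (u : Set (Fin m → ℝ))) ∧
        convexHull ℝ (u : Set (Fin m → ℝ)) ⊆ Metric.thickening (1 / ((k : ℝ) + 1)) (K i) := by
    intro k i
    refine (hc i).closure.exists_subset_interior_convexHull_finset_of_isCompact
      (hb i).isCompact_closure ?_
    exact Metric.isOpen_thickening.mem_nhdsSet.2 (Metric.closure_subset_thickening (hδ k) _)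
  choose V hV1 hV2 using hV
  refine ⟨V, fun k i => (hn i).mono (subset_closure.trans (hV1 k i)), fun S => ?_⟩
  set A := ∑ i ∈ S, K i
  have hA : Convex ℝ A := Convex.finsetSum S fun i _ => hc i
  have hAb : Bornology.IsBounded A := isBounded_finsetSum S fun i _ => hb i
  have hclos : volume (closure A) = volume A :=
    measure_congr (closure_ae_eq_of_null_frontier (hA.addHaar_frontier volume))
  have hlow : ∀ k, A ⊆ ∑ i ∈ S, convexHull ℝ (V k i : Set (Fin m → ℝ)) := by
    intro k x hx
    obtain ⟨g, hg, rfl⟩ := (Set.mem_finsetSum _ _ _).1 hx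
    exact (Set.mem_finsetSum _ _ _).2
      ⟨g, fun hi => interior_subset (hV1 k _ (subset_closure (hg hi))), rfl⟩
  have hup : ∀ k, ∑ i ∈ S, convexHull ℝ (V k i : Set (Fin m → ℝ)) ⊆
      Metric.cthickening (S.card * (1 / ((k : ℝ) + 1))) A := by
    intro k x hx
    obtain ⟨g, hg, rfl⟩ := (Set.mem_finsetSum _ _ _).1 hx
    have hz : ∀ i, ∃ z, i ∈ S → z ∈ K i ∧ dist (g i) z < 1 / ((k : ℝ) + 1) := by
      intro i
      by_cases hi : i ∈ S
      · obtain ⟨z, hz, hd⟩ := Metric.mem_thickening_iff.1 (hV2 k i (hg hi))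
        exact ⟨z, fun _ => ⟨hz, hd⟩⟩
      · exact ⟨0, fun h => absurd h hi⟩
    choose z hz using hz
    refine Metric.mem_cthickening_of_dist_le _ (∑ i ∈ S, z i) _ _
      ((Set.mem_finsetSum _ _ _).2 ⟨z, fun hi => (hz _ hi).1, rfl⟩) ?_
    refine (dist_sum_sum_le _ _ _).trans ?_
    rw [← nsmul_eq_mul]
    exact Finset.sum_le_card_nsmul _ _ _ fun i hi => (hz i hi).2.le
  have hr : Filter.Tendsto (fun k : ℕ => (S.card : ℝ) * (1 / ((k : ℝ) + 1))) Filter.atTop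
      (nhds 0) := by
    simpa using tendsto_one_div_add_atTop_nhds_zero_nat.const_mul (S.card : ℝ)
  have hlim : Filter.Tendsto
      (fun k : ℕ => volume.real (Metric.cthickening (S.card * (1 / ((k : ℝ) + 1))) A))
      Filter.atTop (nhds (volume.real A)) := by
    rw [measureReal_def, ← hclos]
    refine (ENNReal.tendsto_toReal hAb.closure.measure_lt_top.ne).comp ?_
    exact (tendsto_measure_cthickening
      ⟨1, one_pos, hAb.cthickening.measure_lt_top.ne⟩).comp hr
  refine tendsto_of_tendsto_of_tendsto_of_le_of_le tendsto_const_nhds hlim ?_ ?_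
  · intro k
    exact measureReal_mono (hlow k)
      ((measure_mono (hup k)).trans_lt hAb.cthickening.measure_lt_top).ne
  · intro k
    exact measureReal_mono (hup k) hAb.cthickening.measure_lt_top.ne

/-- Volume is a polynomial of degree at most `m` for the Minkowski addition of convex sets in
`ℝᵐ`: differences of order greater than `m` vanish. -/
theorem sum_neg_one_pow_volume_eq_zero [Fintype ι] (hm : m < Fintype.card ι)
    (K : ι → Set (Fin m → ℝ))
    (hc : ∀ i, Convex ℝ (K i)) (hb : ∀ i, Bornology.IsBounded (K i)) (hn : ∀ i, (K i).Nonempty) :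
    ∑ S : Finset ι, (-1 : ℝ) ^ S.card * volume.real (∑ i ∈ S, K i) = 0 := by
  classical
  obtain ⟨V, hV, hlim⟩ := exists_tendsto_volume_sum_convexHull K hc hb hn
  refine tendsto_nhds_unique
    (tendsto_finsetSum _ fun S _ => (hlim S).const_mul ((-1 : ℝ) ^ S.card)) ?_
  refine tendsto_const_nhds.congr fun k => ?_
  rw [sum_neg_one_pow_volume_convexHull (V k) (hV k)]
  symm
  refine integral_eq_zero_of_ae (Filter.Eventually.of_forall fun x => ?_)
  exact sum_neg_one_pow_det_sum_eq_zero _ (by simpa using hm)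

/-- Mixed volumes of convex sets are nonnegative, being limits of integrals of mixed
discriminants of positive semidefinite matrices. -/
theorem sum_neg_one_pow_volume_nonneg (K : Fin m → Set (Fin m → ℝ))
    (hc : ∀ i, Convex ℝ (K i)) (hb : ∀ i, Bornology.IsBounded (K i)) (hn : ∀ i, (K i).Nonempty) :
    0 ≤ (-1 : ℝ) ^ m *
      ∑ S : Finset (Fin m), (-1 : ℝ) ^ S.card * volume.real (∑ i ∈ S, K i) := by
  obtain ⟨V, hV, hlim⟩ := exists_tendsto_volume_sum_convexHull K hc hb hn
  refine ge_of_tendsto' ((tendsto_finsetSum _ fun S _ =>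
    (hlim S).const_mul ((-1 : ℝ) ^ S.card)).const_mul ((-1 : ℝ) ^ m)) fun k => ?_
  rw [sum_neg_one_pow_volume_convexHull (V k) (hV k), ← integral_const_mul]
  refine integral_nonneg fun x => ?_
  have := sum_neg_one_pow_det_sum_nonneg (V k) (fun i => gibbsWeight (V k i) x)
    (fun i v _ => (gibbsWeight_pos x v).le) (fun i v => v - gibbsMean (V k i) x)
  simpa only [Fintype.card_fin, gibbsCov, Pi.zero_apply] using this

end ConvexVolume

/-! ### Hypographs of concave functions -/

namespace ConcaveFn

variable {n : ℕ}

theorem integrableOn (f : ConcaveFn n) :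
    IntegrableOn f (f.dom : Set (Fin n → ℝ)) volume := by
  have hae : interior (f.dom : Set (Fin n → ℝ)) =ᵐ[volume] (f.dom : Set (Fin n → ℝ)) :=
    interior_ae_eq_of_null_frontier (f.dom.convex.addHaar_frontier volume)
  have hmeas : AEStronglyMeasurable f (volume.restrict (f.dom : Set (Fin n → ℝ))) := by
    rw [← Measure.restrict_congr_set hae]
    exact f.concaveOn.continuousOn_interior.aestronglyMeasurable isOpen_interior.measurableSet
  obtain ⟨a, ha⟩ := f.bddBelow
  obtain ⟨b, hb⟩ := f.bddAbove
  refine IntegrableOn.of_bound f.dom.isCompact.measure_lt_top hmeas (max |a| |b|) ?_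
  rw [ae_restrict_iff' f.dom.isCompact.measurableSet]
  refine Filter.Eventually.of_forall fun x hx => ?_
  exact abs_le_max_abs_abs (ha ⟨x, hx, rfl⟩) (hb ⟨x, hx, rfl⟩)

theorem integrableOn_const (f : ConcaveFn n) (c : ℝ) :
    IntegrableOn (fun _ => c) (f.dom : Set (Fin n → ℝ)) volume :=
  MeasureTheory.integrableOn_const f.dom.isCompact.measure_lt_top.ne

theorem snoc_castSucc_eq (x : Fin n → ℝ) (t : ℝ) :
    (fun j : Fin n => Fin.snoc (α := fun _ => ℝ) x t j.castSucc) = x := by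
  ext j
  simp

/-- The set of points lying over the domain of `f`, weakly between the height `c` and the graph. -/
def hypograph (f : ConcaveFn n) (c : ℝ) : Set (Fin (n + 1) → ℝ) :=
  {p | (fun j : Fin n => p j.castSucc) ∈ f.dom ∧
    c ≤ p (Fin.last n) ∧ p (Fin.last n) ≤ f fun j => p j.castSucc}

theorem convex_hypograph (f : ConcaveFn n) (c : ℝ) : Convex ℝ (f.hypograph c) := by
  rintro p ⟨hp, hp1, hp2⟩ q ⟨hq, hq1, hq2⟩ s t hs ht hst
  refine ⟨f.dom.convex hp hq hs ht hst, ?_, ?_⟩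
  · simp only [Pi.add_apply, Pi.smul_apply, smul_eq_mul]
    calc c = s * c + t * c := by rw [← add_mul, hst, one_mul]
      _ ≤ _ := by gcongr
  · refine le_trans ?_ (f.concaveOn.2 hp hq hs ht hst)
    simp only [Pi.add_apply, Pi.smul_apply, smul_eq_mul]
    gcongr

theorem roofBody_eq_hypograph (f : ConcaveFn n) {c : ℝ} (hc : ∀ x ∈ f.dom, c ≤ f x) :
    f.roofBody c = f.hypograph c := by
  refine Set.Subset.antisymm (convexHull_min ?_ (f.convex_hypograph c)) ?_
  · rintro p (⟨x, hx, rfl⟩ | ⟨x, hx, rfl⟩)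
    · simp only [hypograph, Set.mem_ofPred_eq, snoc_castSucc_eq, Fin.snoc_last]
      exact ⟨hx, hc x hx, le_rfl⟩
    · simp only [hypograph, Set.mem_ofPred_eq, snoc_castSucc_eq, Fin.snoc_last]
      exact ⟨hx, le_rfl, hc x hx⟩
  · rintro p ⟨hp, hp1, hp2⟩
    set x : Fin n → ℝ := fun j => p j.castSucc
    have h1 := subset_convexHull ℝ
      ({p | ∃ x ∈ f.dom, p = Fin.snoc (α := fun _ => ℝ) x (f x)} ∪
        {p | ∃ x ∈ f.dom, p = Fin.snoc (α := fun _ => ℝ) x c}) (Or.inl ⟨x, hp, rfl⟩)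
    have h2 := subset_convexHull ℝ
      ({p | ∃ x ∈ f.dom, p = Fin.snoc (α := fun _ => ℝ) x (f x)} ∪
        {p | ∃ x ∈ f.dom, p = Fin.snoc (α := fun _ => ℝ) x c}) (Or.inr ⟨x, hp, rfl⟩)
    have hseg : p (Fin.last n) ∈ segment ℝ (f x) c := by
      rw [segment_symm, segment_eq_Icc (hp1.trans hp2)]
      exact ⟨hp1, hp2⟩
    obtain ⟨a, b, ha, hb, hab, hp⟩ := hseg
    have hpe : p = a • (Fin.snoc (α := fun _ => ℝ) x (f x) : Fin (n + 1) → ℝ) +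
        b • (Fin.snoc (α := fun _ => ℝ) x c : Fin (n + 1) → ℝ) := by
      ext j
      refine Fin.lastCases ?_ (fun j => ?_) j
      · simpa using hp.symm
      · simp [← add_mul, hab, x]
    rw [hpe]
    exact (convex_convexHull ℝ _) h1 h2 ha hb hab

theorem hypograph_nonempty (f : ConcaveFn n) {c : ℝ} (hc : ∀ x ∈ f.dom, c ≤ f x) :
    (f.hypograph c).Nonempty := by
  obtain ⟨x, hx⟩ := f.dom.nonempty
  refine ⟨Fin.snoc (α := fun _ => ℝ) x c, ?_⟩
  simp only [hypograph, Set.mem_ofPred_eq, snoc_castSucc_eq, Fin.snoc_last]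
  exact ⟨hx, le_rfl, hc x hx⟩

theorem isBounded_hypograph (f : ConcaveFn n) (c : ℝ) : Bornology.IsBounded (f.hypograph c) := by
  obtain ⟨b, hb⟩ := f.bddAbove
  obtain ⟨r, hr⟩ := f.dom.isCompact.isBounded.subset_closedBall 0
  refine (Metric.isBounded_closedBall (x := (0 : Fin (n + 1) → ℝ))
    (r := max r (max |c| |b|))).subset ?_
  rintro p ⟨hp, hp1, hp2⟩
  rw [mem_closedBall_zero_iff]
  have hp3 := mem_closedBall_zero_iff.1 (hr hp)
  have h0 : 0 ≤ max r (max |c| |b|) := le_max_of_le_right (le_max_of_le_left (abs_nonneg c))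
  refine (pi_norm_le_iff_of_nonneg h0).2 fun j => ?_
  refine Fin.lastCases ?_ (fun j => ?_) j
  · exact le_max_of_le_right (abs_le_max_abs_abs hp1 (hp2.trans (hb ⟨_, hp, rfl⟩)))
  · exact le_max_of_le_left ((norm_le_pi_norm (fun j : Fin n => p j.castSucc) j).trans hp3)

theorem volume_preimage_regionBetween (f : ConcaveFn n) {u v : (Fin n → ℝ) → ℝ}
    (hu : IntegrableOn u (f.dom : Set (Fin n → ℝ)) volume)
    (hv : IntegrableOn v (f.dom : Set (Fin n → ℝ)) volume) (huv : ∀ x ∈ f.dom, u x ≤ v x) :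
    volume {p : Fin (n + 1) → ℝ | (fun j : Fin n => p j.castSucc) ∈ f.dom ∧
      u (fun j => p j.castSucc) < p (Fin.last n) ∧ p (Fin.last n) < v fun j => p j.castSucc} =
    ENNReal.ofReal (∫ x in (f.dom : Set (Fin n → ℝ)), (v x - u x)) := by
  have h1 : MeasurePreserving ((MeasurableEquiv.piFinSuccAbove (fun _ : Fin (n + 1) => ℝ)
      (Fin.last n)).trans MeasurableEquiv.prodComm) volume (volume.prod volume) :=
    (volume_preserving_piFinSuccAbove (fun _ : Fin (n + 1) => ℝ) (Fin.last n)).trans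
      Measure.measurePreserving_swap
  have h2 := volume_regionBetween_eq_integral hu hv f.dom.isCompact.measurableSet huv
  rw [← h1.measure_preimage_equiv] at h2
  rw [show (∫ x in (f.dom : Set (Fin n → ℝ)), (v x - u x)) =
    ∫ x in (f.dom : Set (Fin n → ℝ)), (v - u) x from rfl, ← h2]
  congr 1
  ext p
  have : ((MeasurableEquiv.piFinSuccAbove (fun _ : Fin (n + 1) => ℝ)
      (Fin.last n)).trans MeasurableEquiv.prodComm) p =
      ((fun j : Fin n => p j.castSucc), p (Fin.last n)) := by
    ext <;> simp [MeasurableEquiv.piFinSuccAbove] <;> rfl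
  simp only [Set.mem_preimage, this]
  rfl

/-- The boundary of the hypograph being negligible, every set between the open and the closed
hypograph has the volume `∫ (f - c)`. -/
theorem volume_real_eq_integral_sub (f : ConcaveFn n) {c : ℝ} (hc : ∀ x ∈ f.dom, c ≤ f x)
    {A : Set (Fin (n + 1) → ℝ)}
    (hA₁ : {p : Fin (n + 1) → ℝ | (fun j : Fin n => p j.castSucc) ∈ f.dom ∧
      c < p (Fin.last n) ∧ p (Fin.last n) < f fun j => p j.castSucc} ⊆ A)
    (hA₂ : A ⊆ f.hypograph c) :
    volume.real A = f.integral - c * volume.real (f.dom : Set (Fin n → ℝ)) := by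
  set W := volume.real (f.dom : Set (Fin n → ℝ))
  have hint : ∀ d e : ℝ, ∫ x in (f.dom : Set (Fin n → ℝ)), (f x + e - d) =
      f.integral + (e - d) * W := by
    intro d e
    simp_rw [add_sub_assoc]
    rw [integral_add f.integrableOn (f.integrableOn_const _), setIntegral_const, smul_eq_mul,
      mul_comm]
    rfl
  have hpos : 0 ≤ f.integral - c * W := by
    have h := hint c 0
    have h0 : 0 ≤ ∫ x in (f.dom : Set (Fin n → ℝ)), (f x + 0 - c) :=
      setIntegral_nonneg f.dom.isCompact.measurableSet fun x hx => by
        have := hc x hx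
        linarith
    rw [h] at h0
    linarith
  have hlow : ENNReal.ofReal (f.integral - c * W) ≤ volume A := by
    refine le_trans (le_of_eq ?_) (measure_mono hA₁)
    rw [f.volume_preimage_regionBetween (f.integrableOn_const c) f.integrableOn hc]
    have := hint c 0
    simp only [add_zero] at this
    rw [this]
    congr 1
    ring
  -- the closed hypograph lies in the open region enlarged by `ε` above and below
  have hup : ∀ ε > 0, volume A ≤ ENNReal.ofReal (f.integral - c * W + 2 * ε * W) := by
    intro ε hε
    have h := f.volume_preimage_regionBetween (f.integrableOn_const (c - ε))
      (f.integrableOn.add (f.integrableOn_const ε)) fun x hx => by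
        have := hc x hx
        simp only [Pi.add_apply]
        linarith
    simp only [Pi.add_apply] at h
    rw [hint (c - ε) ε] at h
    have he : f.integral + (ε - (c - ε)) * W = f.integral - c * W + 2 * ε * W := by ring
    rw [← he, ← h]
    refine measure_mono (hA₂.trans ?_)
    rintro p ⟨hp, hp1, hp2⟩
    exact ⟨hp, by linarith, by linarith⟩
  have hfin : volume A ≠ ⊤ := ne_top_of_le_ne_top ENNReal.ofReal_ne_top (hup 1 one_pos)
  have hW : 0 ≤ W := measureReal_nonneg
  refine le_antisymm ?_ ?_
  · have hε : ∀ ε > 0, volume.real A ≤ f.integral - c * W + 2 * ε * W := by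
      intro ε hε
      exact ENNReal.toReal_le_of_le_ofReal (by positivity) (hup ε hε)
    have hlim : Filter.Tendsto (fun ε : ℝ => f.integral - c * W + 2 * ε * W)
        (nhdsWithin 0 (Set.Ioi 0)) (nhds (f.integral - c * W)) := by
      have : Continuous fun ε : ℝ => f.integral - c * W + 2 * ε * W := by fun_prop
      exact (this.tendsto' 0 _ (by simp)).mono_left nhdsWithin_le_nhds
    exact ge_of_tendsto hlim (eventually_nhdsWithin_of_forall hε)
  · exact (ENNReal.ofReal_le_iff_le_toReal hfin).1 hlow

theorem zero_apply (x : Fin n → ℝ) : (0 : ConcaveFn n) x = 0 := rfl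

theorem integral_zero : (0 : ConcaveFn n).integral = 0 := by
  simp [integral, zero_apply]

theorem coe_dom_sum {ι : Type*} (f : ι → ConcaveFn n) (S : Finset ι) :
    ((∑ i ∈ S, f i).dom : Set (Fin n → ℝ)) = ∑ i ∈ S, ((f i).dom : Set (Fin n → ℝ)) := by
  classical
  induction S using Finset.induction_on with
  | empty => rfl
  | insert i S hi ih =>
    rw [Finset.sum_insert hi, Finset.sum_insert hi, dom_add, ConvexBody.coe_add, ih]

theorem add_le_add_apply (f g : ConcaveFn n) {y z : Fin n → ℝ} (hy : y ∈ f.dom) (hz : z ∈ g.dom) :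
    f y + g z ≤ (f + g) (y + z) :=
  le_csSup (splitValues_bddAbove f g _) ⟨y, hy, z, hz, rfl, rfl⟩

/-- Minkowski sums of hypographs lie between the hypograph of the sup-convolution and the same
set with the graph removed (except at the bottom level); the graph can be missed because the
supremum in the sup-convolution need not be attained. -/
theorem sum_hypograph {ι : Type*} (f : ι → ConcaveFn n) (c : ι → ℝ)
    (hc : ∀ i, ∀ x ∈ (f i).dom, c i ≤ f i x) (S : Finset ι) :
    (∀ x ∈ (∑ i ∈ S, f i).dom, ∑ i ∈ S, c i ≤ (∑ i ∈ S, f i) x) ∧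
    ∑ i ∈ S, (f i).hypograph (c i) ⊆ (∑ i ∈ S, f i).hypograph (∑ i ∈ S, c i) ∧
    {p : Fin (n + 1) → ℝ | (fun j : Fin n => p j.castSucc) ∈ (∑ i ∈ S, f i).dom ∧
      (p (Fin.last n) = ∑ i ∈ S, c i ∨ (∑ i ∈ S, c i < p (Fin.last n) ∧
        p (Fin.last n) < (∑ i ∈ S, f i) fun j => p j.castSucc))} ⊆
      ∑ i ∈ S, (f i).hypograph (c i) := by
  classical
  induction S using Finset.induction_on with
  | empty =>
    simp only [Finset.sum_empty]
    refine ⟨fun x _ => le_rfl, ?_, ?_⟩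
    · rintro p hp
      rw [Set.mem_zero] at hp
      subst hp
      exact ⟨rfl, le_rfl, le_rfl⟩
    · rintro p ⟨hp, hp'⟩
      have hp0 : (fun j : Fin n => p j.castSucc) = 0 := hp
      have hl : p (Fin.last n) = 0 := by
        rcases hp' with h | ⟨h1, h2⟩
        · exact h
        · rw [zero_apply] at h2
          exact absurd h1 (not_lt.2 h2.le)
      rw [Set.mem_zero]
      ext j
      refine Fin.lastCases hl (fun j => ?_) j
      exact congrFun hp0 j
  | insert i S hi ih =>
    obtain ⟨ih1, ih2, ih3⟩ := ih
    simp only [Finset.sum_insert hi]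
    set g := ∑ i ∈ S, f i
    set d := ∑ i ∈ S, c i
    refine ⟨?_, ?_, ?_⟩
    · rintro _ ⟨y, hy, z, hz, rfl⟩
      exact (add_le_add (hc i y hy) (ih1 z hz)).trans (add_le_add_apply (f i) g hy hz)
    · rintro _ ⟨p, ⟨hp, hp1, hp2⟩, q, hq, rfl⟩
      obtain ⟨hq, hq1, hq2⟩ := ih2 hq
      refine ⟨⟨_, hp, _, hq, rfl⟩, add_le_add hp1 hq1, ?_⟩
      exact (add_le_add hp2 hq2).trans (add_le_add_apply (f i) g hp hq)
    · rintro p ⟨hp, hp'⟩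
      -- it suffices to split the base point and the height
      have key : ∀ y ∈ (f i).dom, ∀ z ∈ g.dom, ∀ a b : ℝ, y + z = (fun j : Fin n => p j.castSucc) →
          a + b = p (Fin.last n) → c i ≤ a → a ≤ f i y → (b = d ∨ (d < b ∧ b < g z)) →
          p ∈ (f i).hypograph (c i) + ∑ i ∈ S, (f i).hypograph (c i) := by
        intro y hy z hz a b hyz hab ha1 ha2 hb
        refine ⟨Fin.snoc (α := fun _ => ℝ) y a, ?_, Fin.snoc (α := fun _ => ℝ) z b, ih3 ?_, ?_⟩
        · simp only [hypograph, Set.mem_ofPred_eq, snoc_castSucc_eq, Fin.snoc_last]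
          exact ⟨hy, ha1, ha2⟩
        · simp only [Set.mem_ofPred_eq, snoc_castSucc_eq, Fin.snoc_last]
          exact ⟨hz, hb⟩
        · ext j
          refine Fin.lastCases ?_ (fun j => ?_) j
          · simpa using hab
          · simpa using congrFun hyz j
      rcases hp' with h | ⟨h1, h2⟩
      · obtain ⟨y, hy, z, hz, hyz⟩ := hp
        exact key y hy z hz (c i) d hyz h.symm le_rfl (hc i y hy) (Or.inl rfl)
      · obtain ⟨y, hy, z, hz, hyz, hlt⟩ := (lt_add_apply (f i) g hp).1 h2
        rcases le_or_gt (p (Fin.last n) - f i y) d with hle | hgt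
        · exact key y hy z hz (p (Fin.last n) - d) d hyz (by ring) (by linarith) (by linarith)
            (Or.inl rfl)
        · exact key y hy z hz (f i y) (p (Fin.last n) - f i y) hyz (by ring) (hc i y hy) le_rfl
            (Or.inr ⟨hgt, by linarith⟩)

/-- The integral of an iterated sup-convolution, in terms of volumes of Minkowski sums. -/
theorem integral_sum {ι : Type*} (f : ι → ConcaveFn n) (c : ι → ℝ)
    (hc : ∀ i, ∀ x ∈ (f i).dom, c i ≤ f i x) (S : Finset ι) :
    (∑ i ∈ S, f i).integral = volume.real (∑ i ∈ S, (f i).hypograph (c i)) +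
      (∑ i ∈ S, c i) * volume.real (∑ i ∈ S, ((f i).dom : Set (Fin n → ℝ))) := by
  obtain ⟨h1, h2, h3⟩ := sum_hypograph f c hc S
  rw [volume_real_eq_integral_sub _ h1 (fun p hp => h3 ⟨hp.1, Or.inr hp.2⟩) h2, coe_dom_sum]
  ring

end ConcaveFn

/-! ### Polarization -/

section Polarization

variable {ι : Type*} [Fintype ι]

theorem sum_finset_option [DecidableEq ι] (G : Finset (Option ι) → ℝ) :
    ∑ S, G S = ∑ S : Finset ι, G (S.map Function.Embedding.some) +
      ∑ S : Finset ι, G (Finset.insertNone S) := by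
  rw [← Finset.sum_filter_add_sum_filter_not Finset.univ (fun S : Finset (Option ι) => none ∉ S)]
  congr 1
  · refine Finset.sum_bij' (fun S _ => Finset.eraseNone S)
      (fun S _ => S.map Function.Embedding.some) ?_ ?_ ?_ ?_ ?_
    · simp
    · simp
    · intro S hS
      rw [Finset.map_some_eraseNone, Finset.erase_eq_of_notMem (Finset.mem_filter.1 hS).2]
    · intro S _
      exact Finset.eraseNone_map_some S
    · intro S hS
      rw [Finset.map_some_eraseNone, Finset.erase_eq_of_notMem (Finset.mem_filter.1 hS).2]
  · have hmem : ∀ S ∈ Finset.univ.filter (fun S : Finset (Option ι) => ¬none ∉ S),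
        Finset.insertNone (Finset.eraseNone S) = S := by
      intro S hS
      rw [Finset.insertNone_eraseNone,
        Finset.insert_eq_of_mem (not_not.1 (Finset.mem_filter.1 hS).2)]
    refine Finset.sum_bij' (fun S _ => Finset.eraseNone S)
      (fun S _ => Finset.insertNone S) ?_ ?_ hmem ?_ ?_
    · simp
    · simp
    · intro S _
      exact Finset.eraseNone_insertNone S
    · intro S hS
      rw [hmem S hS]

theorem sum_finset_map_embedding [DecidableEq ι] {α : Type*} [Fintype α] (e : α ↪ ι) (i : ι)
    (he : ∀ j, j ∈ Set.range e ↔ j ≠ i) (G : Finset ι → ℝ) :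
    ∑ S : Finset α, G (S.map e) = ∑ S : Finset ι with i ∉ S, G S := by
  refine Finset.sum_bij (fun S _ => S.map e) ?_ ?_ ?_ ?_
  · intro S _
    simp only [Finset.mem_filter, Finset.mem_univ, true_and, Finset.mem_map, not_exists, not_and]
    exact fun a _ hai => (he i).1 ⟨a, hai⟩ rfl
  · intro S _ T _ h
    exact Finset.map_injective e h
  · intro S hS
    have hS' : S ⊆ (Finset.univ : Finset α).map e := by
      intro j hj
      have hji : j ≠ i := fun h => (Finset.mem_filter.1 hS).2 (h ▸ hj)
      obtain ⟨a, rfl⟩ := (he j).2 hji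
      exact Finset.mem_map_of_mem e (Finset.mem_univ a)
    obtain ⟨T, _, rfl⟩ := Finset.subset_map_iff.1 hS'
    exact ⟨T, Finset.mem_univ _, rfl⟩
  · intro S _
    rfl

variable {M : Type*} [AddCommMonoid M]

/-- The polarization of `Φ`: the alternating sum, over subsets, of the values of `Φ` at the partial
sums of a family. -/
def alternatingSum (Φ : M → ℝ) (f : ι → M) : ℝ :=
  ∑ S : Finset ι, (-1 : ℝ) ^ S.card * Φ (∑ i ∈ S, f i)

theorem alternatingSum_perm (Φ : M → ℝ) (f : ι → M) (σ : Equiv.Perm ι) :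
    alternatingSum Φ (fun i => f (σ i)) = alternatingSum Φ f := by
  refine Fintype.sum_equiv (Equiv.finsetCongr σ) _ _ fun S => ?_
  simp

theorem alternatingSum_update [DecidableEq ι] (Φ : M → ℝ) (f : ι → M) (i : ι) (g : M) :
    alternatingSum Φ (Function.update f i g) = ∑ S ∈ (Finset.univ.erase i).powerset,
      (-1 : ℝ) ^ S.card * (Φ (∑ j ∈ S, f j) - Φ (g + ∑ j ∈ S, f j)) := by
  have huniv : (Finset.univ : Finset (Finset ι)) =
      (insert i (Finset.univ.erase i)).powerset := by
    rw [Finset.insert_erase (Finset.mem_univ i), Finset.powerset_univ]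
  rw [alternatingSum, huniv, Finset.sum_powerset_insert (Finset.notMem_erase i _),
    ← Finset.sum_add_distrib]
  refine Finset.sum_congr rfl fun S hS => ?_
  have hi : i ∉ S := fun h => Finset.notMem_erase i _ (Finset.mem_powerset.1 hS h)
  have h1 : ∑ j ∈ S, Function.update f i g j = ∑ j ∈ S, f j :=
    Finset.sum_congr rfl fun j hj => Function.update_of_ne (ne_of_mem_of_not_mem hj hi) _ _
  rw [Finset.sum_insert hi, h1, Function.update_self, Finset.card_insert_of_notMem hi]
  ring

/-- If the differences of `Φ` of one order more vanish, then the polarization of `Φ` is additive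
in each variable. -/
theorem alternatingSum_update_add [DecidableEq ι] (Φ : M → ℝ)
    (hΦ : ∀ F : Option ι → M, alternatingSum Φ F = 0) (f : ι → M) (i : ι) (g h : M) :
    alternatingSum Φ (Function.update f i (g + h)) =
      alternatingSum Φ (Function.update f i g) + alternatingSum Φ (Function.update f i h) := by
  -- the vanishing difference says that the polarization does not see the base point `h`
  have h1 : alternatingSum Φ (Function.update f i g) =
      alternatingSum (fun x => Φ (h + x)) (Function.update f i g) := by
    have h0 := hΦ fun o => o.elim h (Function.update f i g)
    rw [alternatingSum, sum_finset_option] at h0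
    simp only [Finset.card_map, Finset.sum_map, Function.Embedding.some_apply, Option.elim_some,
      Finset.card_insertNone, Finset.sum_insertNone, Option.elim_none, pow_succ, mul_neg_one,
      neg_mul, Finset.sum_neg_distrib] at h0
    exact eq_of_sub_eq_zero ((sub_eq_add_neg _ _).trans h0)
  rw [h1]
  simp only [alternatingSum_update, ← Finset.sum_add_distrib]
  refine Finset.sum_congr rfl fun S _ => ?_
  rw [show g + h + ∑ j ∈ S, f j = h + (g + ∑ j ∈ S, f j) by abel]
  ring

theorem sum_neg_one_pow_weight_mul [DecidableEq ι] (c : ι → ℝ) (W : Finset ι → ℝ) :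
    ∑ S : Finset ι, (-1 : ℝ) ^ S.card * ((∑ i ∈ S, c i) * W S) =
      ∑ i, c i * (∑ S : Finset ι, (-1 : ℝ) ^ S.card * W S -
        ∑ S : Finset ι with i ∉ S, (-1 : ℝ) ^ S.card * W S) := by
  have h1 : ∀ i, ∑ S : Finset ι, (-1 : ℝ) ^ S.card * W S -
      ∑ S : Finset ι with i ∉ S, (-1 : ℝ) ^ S.card * W S =
      ∑ S : Finset ι, if i ∈ S then (-1 : ℝ) ^ S.card * W S else 0 := by
    intro i
    rw [← Finset.sum_filter_add_sum_filter_not Finset.univ (fun S : Finset ι => i ∈ S),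
      add_sub_cancel_right, Finset.sum_filter]
  simp_rw [h1, Finset.mul_sum]
  rw [Finset.sum_comm]
  refine Finset.sum_congr rfl fun S _ => ?_
  simp only [mul_ite, mul_zero]
  rw [← Finset.sum_filter, Finset.filter_mem_eq_inter, Finset.univ_inter, Finset.sum_mul,
    Finset.mul_sum]
  exact Finset.sum_congr rfl fun i _ => by ring

theorem sum_finset_neg_one_pow_mul_card_pow (N : ℕ) :
    ∑ S : Finset (Fin N), (-1 : ℝ) ^ (N - S.card) * (S.card : ℝ) ^ N = (N.factorial : ℝ) := by
  have h1 := Finset.sum_powerset_apply_card (x := (Finset.univ : Finset (Fin N)))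
    (fun k => (-1 : ℝ) ^ (N - k) * (k : ℝ) ^ N)
  rw [Finset.powerset_univ, Finset.card_univ, Fintype.card_fin] at h1
  rw [h1]
  have h2 := congrFun (fwdDiff_iter_eq_factorial (R := ℝ) (n := N)) 0
  rw [fwdDiff_iter_eq_sum_shift] at h2
  refine Eq.trans (Finset.sum_congr rfl fun k _ => ?_) h2
  simp
  ring

end Polarization

/-! ### Mixed integrals -/

section MixedIntegral

variable {n : ℕ}

theorem neg_one_pow_sub_card {N : ℕ} (S : Finset (Fin N)) :
    (-1 : ℝ) ^ (N - S.card) = (-1) ^ N * (-1) ^ S.card := by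
  have h : S.card ≤ N := by simpa using S.card_le_univ
  generalize S.card = s at h
  obtain ⟨k, rfl⟩ := Nat.exists_eq_add_of_le h
  rw [Nat.add_sub_cancel_left, pow_add, mul_comm ((-1 : ℝ) ^ s), mul_assoc, ← pow_add,
    Even.neg_one_pow ⟨_, rfl⟩, mul_one]

theorem sum_nonempty_eq_alternating {N : ℕ} (W : Finset (Fin N) → ℝ) (hW : W ∅ = 0) :
    ∑ S : Finset (Fin N) with S.Nonempty, (-1 : ℝ) ^ (N - S.card) * W S =
      (-1 : ℝ) ^ N * ∑ S : Finset (Fin N), (-1 : ℝ) ^ S.card * W S := by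
  rw [Finset.mul_sum, Finset.sum_filter]
  refine Finset.sum_congr rfl fun S _ => ?_
  split_ifs with h
  · rw [neg_one_pow_sub_card, mul_assoc]
  · rw [Finset.not_nonempty_iff_eq_empty.1 h, hW, mul_zero, mul_zero]

theorem mixedIntegral_eq_alternatingSum (f : Fin (n + 1) → ConcaveFn n) :
    mixedIntegral f = (-1 : ℝ) ^ (n + 1) * alternatingSum ConcaveFn.integral f :=
  sum_nonempty_eq_alternating (fun S => (∑ i ∈ S, f i).integral) (by
    simp [ConcaveFn.integral_zero])

/-- In positive dimension the empty Minkowski sum, a point, contributes no volume. In dimension `0`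
it contributes `1`, and the formula fails. -/
theorem mixedVolume_eq_alternatingSum (hn : 0 < n) (K : Fin n → Set (Fin n → ℝ)) :
    mixedVolume K =
      (-1 : ℝ) ^ n * alternatingSum (volume : Measure (Fin n → ℝ)).real K := by
  have : Nonempty (Fin n) := ⟨⟨0, hn⟩⟩
  refine sum_nonempty_eq_alternating (fun S => volume.real (∑ i ∈ S, K i)) ?_
  rw [Finset.sum_empty, ← Set.singleton_zero, measureReal_def, measure_singleton,
    ENNReal.toReal_zero]

theorem ConcaveFn.exists_le (f : ConcaveFn n) : ∃ c, ∀ x ∈ f.dom, c ≤ f x := by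
  obtain ⟨c, hc⟩ := f.bddBelow
  exact ⟨c, fun x hx => hc ⟨x, hx, rfl⟩⟩

variable {ι : Type*} [Fintype ι]

theorem alternatingSum_volume_dom_eq_zero (hι : n < Fintype.card ι) (f : ι → ConcaveFn n) :
    alternatingSum (volume : Measure (Fin n → ℝ)).real
      (fun i => ((f i).dom : Set (Fin n → ℝ))) = 0 :=
  sum_neg_one_pow_volume_eq_zero hι _ (fun i => (f i).dom.convex)
    (fun i => (f i).dom.isCompact.isBounded) fun i => (f i).dom.nonempty

/-- The polarized form of `∫ f = Vol (hypograph f c) + c Vol (dom f)`. -/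
theorem alternatingSum_integral [DecidableEq ι] (f : ι → ConcaveFn n) (c : ι → ℝ)
    (hc : ∀ i, ∀ x ∈ (f i).dom, c i ≤ f i x) :
    alternatingSum ConcaveFn.integral f =
      alternatingSum (volume : Measure (Fin (n + 1) → ℝ)).real
        (fun i => (f i).hypograph (c i)) +
      ∑ i, c i * (alternatingSum (volume : Measure (Fin n → ℝ)).real
          (fun i => ((f i).dom : Set (Fin n → ℝ))) -
        ∑ S : Finset ι with i ∉ S, (-1 : ℝ) ^ S.card *
          volume.real (∑ i ∈ S, ((f i).dom : Set (Fin n → ℝ)))) := by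
  simp only [alternatingSum]
  rw [← sum_neg_one_pow_weight_mul c
    fun S => volume.real (∑ i ∈ S, ((f i).dom : Set (Fin n → ℝ))), ← Finset.sum_add_distrib]
  refine Finset.sum_congr rfl fun S _ => ?_
  rw [ConcaveFn.integral_sum f c hc S, mul_add]

theorem alternatingSum_integral_eq_zero [DecidableEq ι] (hι : n + 1 < Fintype.card ι)
    (f : ι → ConcaveFn n) :
    alternatingSum ConcaveFn.integral f = 0 := by
  choose c hc using fun i => (f i).exists_le
  rw [alternatingSum_integral f c hc, alternatingSum_volume_dom_eq_zero (by omega)]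
  have h1 : alternatingSum (volume : Measure (Fin (n + 1) → ℝ)).real
      (fun i => (f i).hypograph (c i)) = 0 :=
    sum_neg_one_pow_volume_eq_zero hι _ (fun i => (f i).convex_hypograph _)
      (fun i => (f i).isBounded_hypograph _) fun i => (f i).hypograph_nonempty (hc i)
  rw [h1, zero_add]
  refine Finset.sum_eq_zero fun i _ => ?_
  have h2 := alternatingSum_volume_dom_eq_zero (n := n) (ι := {j // j ≠ i})
    (by rw [Fintype.card_subtype_compl, Fintype.card_subtype_eq]; omega) fun j => f j
  have h3 := sum_finset_map_embedding (Function.Embedding.subtype fun j => j ≠ i) i (by simp)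
    fun S => (-1 : ℝ) ^ S.card * volume.real (∑ i ∈ S, ((f i).dom : Set (Fin n → ℝ)))
  simp only [Finset.card_map, Finset.sum_map, Function.Embedding.subtype_apply] at h3
  rw [← h3]
  unfold alternatingSum at h2
  rw [h2]
  simp

theorem nsmul_eq_smul_of_convex {E : Type*} [AddCommGroup E] [Module ℝ E] {K : Set E}
    (hK : Convex ℝ K) (hne : K.Nonempty) (k : ℕ) : k • K = (k : ℝ) • K := by
  induction k with
  | zero => simp [Set.zero_smul_set hne]
  | succ k ih =>
    rw [succ_nsmul, ih, Nat.cast_succ, hK.add_smul k.cast_nonneg zero_le_one, one_smul]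

/-- The integral is homogeneous of degree `n + 1` for the sup-convolution. -/
theorem ConcaveFn.integral_nsmul (f : ConcaveFn n) (k : ℕ) :
    (k • f).integral = (k : ℝ) ^ (n + 1) * f.integral := by
  obtain ⟨c, hc⟩ := f.exists_le
  have h1 := integral_sum (fun _ : Fin k => f) (fun _ => c) (fun _ => hc) Finset.univ
  have h2 := integral_sum (fun _ : Fin 1 => f) (fun _ => c) (fun _ => hc) Finset.univ
  simp only [Finset.sum_const, Finset.card_univ, Fintype.card_fin, one_smul] at h1 h2
  rw [h1, h2, nsmul_eq_smul_of_convex (f.convex_hypograph c) (f.hypograph_nonempty hc),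
    nsmul_eq_smul_of_convex f.dom.convex f.dom.nonempty]
  have hk : (0 : ℝ) ≤ k := k.cast_nonneg
  simp only [measureReal_def, Measure.addHaar_smul, Module.finrank_fin_fun, ENNReal.toReal_mul,
    abs_of_nonneg (pow_nonneg hk _), ENNReal.toReal_ofReal (pow_nonneg hk _), nsmul_eq_mul]
  ring

theorem mixedIntegral_const (f : ConcaveFn n) :
    mixedIntegral (fun _ : Fin (n + 1) => f) = (Nat.factorial (n + 1) : ℝ) * f.integral := by
  rw [mixedIntegral_eq_alternatingSum, ← sum_finset_neg_one_pow_mul_card_pow, alternatingSum,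
    Finset.mul_sum, Finset.sum_mul]
  refine Finset.sum_congr rfl fun S _ => ?_
  rw [Finset.sum_const, ConcaveFn.integral_nsmul, neg_one_pow_sub_card]
  ring

theorem mixedIntegral_nonneg (f : Fin (n + 1) → ConcaveFn n)
    (hf : ∀ i, ∀ x ∈ (f i).dom, 0 ≤ f i x) : 0 ≤ mixedIntegral f := by
  rw [mixedIntegral_eq_alternatingSum, alternatingSum_integral f (fun _ => 0) hf]
  simp only [zero_mul, Finset.sum_const_zero, add_zero]
  exact sum_neg_one_pow_volume_nonneg _ (fun i => (f i).convex_hypograph _)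
    (fun i => (f i).isBounded_hypograph _) fun i => (f i).hypograph_nonempty (hf i)

theorem mixedIntegral_eq_mixedVolume (hn : 0 < n) (f : Fin (n + 1) → ConcaveFn n)
    (c : Fin (n + 1) → ℝ) (hc : ∀ i, ∀ x ∈ (f i).dom, c i ≤ f i x) :
    mixedIntegral f = mixedVolume (fun i => (f i).roofBody (c i)) +
      ∑ i : Fin (n + 1), c i *
        mixedVolume (fun j : Fin n => ((f (i.succAbove j)).dom : Set (Fin n → ℝ))) := by
  have hroof : (fun i => (f i).roofBody (c i)) = fun i => (f i).hypograph (c i) :=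
    funext fun i => (f i).roofBody_eq_hypograph (hc i)
  rw [mixedIntegral_eq_alternatingSum, alternatingSum_integral f c hc, hroof,
    mixedVolume_eq_alternatingSum n.succ_pos, mul_add, Finset.mul_sum,
    alternatingSum_volume_dom_eq_zero (by simp)]
  congr 1
  refine Finset.sum_congr rfl fun i _ => ?_
  have h := sum_finset_map_embedding i.succAboveEmb i
    (fun j => by
      rw [Fin.coe_succAboveEmb, Fin.range_succAbove, Set.mem_compl_singleton_iff])
    fun S => (-1 : ℝ) ^ S.card * volume.real (∑ i ∈ S, ((f i).dom : Set (Fin n → ℝ)))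
  simp only [Finset.card_map, Finset.sum_map, Fin.coe_succAboveEmb] at h
  rw [← h, mixedVolume_eq_alternatingSum hn, alternatingSum]
  ring

end MixedIntegral

theorem mainTheorem3 (n : ℕ) :
    -- the integrals that occur are integrals of integrable functions
    (∀ f : ConcaveFn n, IntegrableOn f (f.dom : Set (Fin n → ℝ)) volume) ∧
    -- (a) symmetry, and additivity in each variable for the sup-convolution
    (∀ (f : Fin (n + 1) → ConcaveFn n) (σ : Equiv.Perm (Fin (n + 1))),
      mixedIntegral (fun i => f (σ i)) = mixedIntegral f) ∧
    (∀ (f : Fin (n + 1) → ConcaveFn n) (i : Fin (n + 1)) (g h : ConcaveFn n),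
      mixedIntegral (Function.update f i (g + h)) =
        mixedIntegral (Function.update f i g) + mixedIntegral (Function.update f i h)) ∧
    -- (b)
    (∀ f : ConcaveFn n,
      mixedIntegral (fun _ : Fin (n + 1) => f) =
        (Nat.factorial (n + 1) : ℝ) * ∫ x in (f.dom : Set (Fin n → ℝ)), f x) ∧
    -- (c)
    (∀ f : Fin (n + 1) → ConcaveFn n, (∀ i, ∀ x ∈ (f i).dom, 0 ≤ f i x) →
      0 ≤ mixedIntegral f) ∧
    -- (d)
    (0 < n → ∀ (f : Fin (n + 1) → ConcaveFn n) (μ : Fin (n + 1) → ℝ),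
      (∀ i, μ i ≤ 0 ∧ ∀ x ∈ (f i).dom, μ i ≤ f i x) →
      mixedIntegral f =
        mixedVolume (fun i => (f i).roofBody (μ i)) +
          ∑ i : Fin (n + 1), μ i *
            mixedVolume (fun j : Fin n => ((f (i.succAbove j)).dom : Set (Fin n → ℝ)))) := by
  refine ⟨ConcaveFn.integrableOn, ?_, ?_, mixedIntegral_const, mixedIntegral_nonneg, ?_⟩
  · intro f σ
    rw [mixedIntegral_eq_alternatingSum, mixedIntegral_eq_alternatingSum, alternatingSum_perm]
  · intro f i g h
    simp only [mixedIntegral_eq_alternatingSum]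
    rw [alternatingSum_update_add ConcaveFn.integral
      (fun F => alternatingSum_integral_eq_zero (by simp) F), mul_add]
  · intro hn f μ hμ
    exact mixedIntegral_eq_mixedVolume hn f μ fun i => (hμ i).2
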